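/- Let $d\ge 2$ and let $\Omega\subset\mathbb R^d$ be compact, convex and symmetric about the origin ($x\in\Omega\Rightarrow -x\in\Omega$), with non-empty interior. For a set $\Omega'\subset\mathbb R^k$, let $\mathcal B_{\Omega'}$ be the set of $f\in L^2(\mathbb R^k)$ whose Fourier transform $F(\omega)=\int f(r)e^{-\mathsf i\langle\omega,r\rangle}dr$ vanishes outside $\Omega'$ (for bounded $\Omega'$, point values of $f$ refer to its continuous representative). Let $v_1,\dots,v_d$ be a basis of $\mathbb R^d$ with $\langle v_i,v_d\rangle=\delta_{id}$ for all $i\le d$, and let $P=\{p_m:m\in\mathbb Z^{d-1}\}$ be the uniform set of parallel lines $p_m(t)=\sum_{i=1}^{d-1}m_iv_i+tv_d$, $t\in\mathbb R$. Let $\mathcal D^P(a,x)$ be the total length of the portions of these lines in the closed ball $B_a^d(x)$ of radius $a$ about $x$, and let $$\ell(P)=\limsup_{a\to\infty}\frac{\sup_{x\in\mathbb R^d}\mathcal D^P(a,x)}{\mathrm{Vol}(B^d_a(0))}$$ be the path density of $P$. $P$ is a Nyquist trajectory set for $\Omega$ if (i) there is a uniformly discrete set $\Lambda$ of points on the lines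 of $P$ such that every (complex-valued) $f\in\mathcal B_\Omega$ is uniquely determined by its values on $\Lambda$, and (ii) for every $x\in\mathbb R^d$ the portion of $P$ in $B_a^d(x)$ is contained in a continuous curve of length at most $\mathcal D^P(a,x)+o(a^d)$ as $a\to\infty$. Let $U$ be a real orthogonal $d\times d$ matrix with $Uv_d=e^d$, the $d$-th standard unit vector, let $$\hat\Omega^U=\Big\{s\in\mathbb R^{d-1}:U^{-1}\begin{pmatrix}s\\0\end{pmatrix}\in\Omega\Big\},$$ let $\breve v_i\in\mathbb R^{d-1}$ be $Uv_i$ with its last component omitted, and let $b^U=\{\sum_{i=1}^{d-1}m_i\breve v_i:m\in\mathbb Z^{d-1}\}$. Then $P$ is a Nyquist trajectory set for $\Omega$ if and only if $b^U$ is a sampling lattice for $\hat\Omega^U$, i.e. $b^U$ is the lattice generated by a basis of $\mathbb R^{d-1}$ and every real-valued field in $\mathcal B_{\hat\Omega^U}$ is uniquely determined by its values on $b^U$. Furthermore, the sampling density of $b^U$, i.e. the limit as $a\to\infty$ of the number of points of $b^U$ in a ball of radius $a$ (about any centre) divided by the volume of that ball, exists and equals $\ell(P)$. -/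

import Mathlib

open MeasureTheory Filter Topology
open scoped ENNReal FourierTransform

namespace PathSampling

noncomputable section

/-- `ℝ^d` with its Euclidean norm, inner product and Lebesgue measure. -/
abbrev Space (d : ℕ) : Type := EuclideanSpace ℝ (Fin d)

/-! ### Bandlimited fields -/

/-- `f` is a finite-energy field on `ℝ^d` bandlimited to `Ω`: `f ∈ L²` and its (`L²`) Fourier
transform `F(ω) = ∫ f(r) exp(-i⟨ω, r⟩) dr` vanishes (almost everywhere) outside `Ω`. Mathlib's `𝓕`
uses the kernel `exp(-2πi⟨ξ, r⟩)`, so that `F(ω) = (𝓕 f)(ω / (2π))`. Point values of such fields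
(for bounded `Ω`) refer to the continuous representative, so `f` is required to be continuous. -/
def IsBandlimited {d : ℕ} (Ω : Set (Space d)) (f : Space d → ℂ) : Prop :=
  Continuous f ∧ ∃ hf : MemLp f 2 (volume : Measure (Space d)),
    ∀ᵐ ω : Space d, ω ∉ Ω →
      (𝓕 (hf.toLp f) : Lp ℂ 2 (volume : Measure (Space d))) ((2 * Real.pi)⁻¹ • ω) = 0

/-- Distinct points of `Λ` are separated by some uniform positive distance. -/
def IsUniformlyDiscrete {d : ℕ} (Λ : Set (Space d)) : Prop :=
  ∃ r : ℝ, 0 < r ∧ ∀ x ∈ Λ, ∀ y ∈ Λ, x ≠ y → r < ‖x - y‖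

/-- `Λ` is uniformly discrete and every field bandlimited to `Ω` is uniquely determined by its
values on `Λ`. -/
def IsSamplingSet {d : ℕ} (Ω : Set (Space d)) (Λ : Set (Space d)) : Prop :=
  IsUniformlyDiscrete Λ ∧
    ∀ f g : Space d → ℂ, IsBandlimited Ω f → IsBandlimited Ω g →
      (∀ x ∈ Λ, f x = g x) → f = g

/-! ### Trajectory sets -/

/-- A countable collection of (differentiable) trajectories `p_i : ℝ → ℝ^d`. -/
structure TrajectorySet (d : ℕ) where
  /-- The index set. -/
  Index : Type
  countable : Countable Index
  /-- The trajectories. -/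
  path : Index → ℝ → Space d
  differentiable : ∀ i, Differentiable ℝ (path i)

namespace TrajectorySet

variable {d : ℕ} (P : TrajectorySet d)

/-- The set of all points on the trajectories. -/
def points : Set (Space d) := {y | ∃ i t, P.path i t = y}

/-- Total arc length of the trajectories within the closed ball of radius `a` around `x`. -/
def arcLengthIn (a : ℝ) (x : Space d) : ℝ≥0∞ :=
  ∑' i, ∫⁻ t in {t : ℝ | ‖P.path i t - x‖ ≤ a}, ‖deriv (P.path i) t‖ₑ

/-- The path density `ℓ(P)`: the upper limit, as the radius tends to infinity, of the largest arc
length inside a ball divided by the volume of the ball. -/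
def pathDensity : ℝ≥0∞ :=
  limsup (fun a : ℝ => (⨆ x : Space d, P.arcLengthIn a x) /
    volume (Metric.closedBall (0 : Space d) a)) atTop

/-- For every centre `x`, the part of the trajectory set inside the ball of radius `a` around `x`
is contained in one continuous curve whose length is at most the total arc length inside that ball
plus `o(a^d)` as `a → ∞`. -/
def IsNondegenerate : Prop :=
  ∀ x : Space d, ∃ h : ℝ → ℝ, h =o[atTop] (fun a : ℝ => a ^ d) ∧
    ∀ᶠ a : ℝ in atTop, ∃ γ : ℝ → Space d, ContinuousOn γ (Set.Icc 0 1) ∧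
      eVariationOn γ (Set.Icc 0 1) ≤ P.arcLengthIn a x + ENNReal.ofReal (h a) ∧
      P.points ∩ Metric.closedBall x a ⊆ γ '' Set.Icc 0 1

/-- `P` is a Nyquist trajectory set for `Ω`: some uniformly discrete set of points on the
trajectories determines all fields bandlimited to `Ω`, and `P` is non-degenerate. -/
def IsNyquist (Ω : Set (Space d)) : Prop :=
  (∃ Λ : Set (Space d), Λ ⊆ P.points ∧ IsSamplingSet Ω Λ) ∧ P.IsNondegenerate

end TrajectorySet

/-- The uniform set of the vectors `v_1, …, v_{n+1}` of `ℝ^{n+1}`: the parallel lines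
`p_m(t) = m_1 v_1 + ⋯ + m_n v_n + t v_{n+1}` with `m ∈ ℤ^n`. -/
def uniformSet {n : ℕ} (v : Fin (n + 1) → Space (n + 1)) : TrajectorySet (n + 1) where
  Index := Fin n → ℤ
  countable := inferInstance
  path m t := ∑ i : Fin n, (m i : ℝ) • v i.castSucc + t • v (Fin.last n)
  differentiable _ := by fun_prop

/-! ### Lattices of points -/

/-- All integer combinations of the vectors `w_1, …, w_n` of `ℝ^n`. -/
def latticePoints {n : ℕ} (w : Fin n → Space n) : Set (Space n) :=
  Set.range fun m : Fin n → ℤ => ∑ i, (m i : ℝ) • w i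

/-- `b` is a sampling lattice for `Ω ⊆ ℝ^n`: it is the lattice generated by some basis of `ℝ^n`,
and every real-valued field bandlimited to `Ω` is uniquely determined by its values on `b`. -/
def IsSamplingLattice {n : ℕ} (Ω : Set (Space n)) (b : Set (Space n)) : Prop :=
  (∃ w : Fin n → Space n, LinearIndependent ℝ w ∧ b = latticePoints w) ∧
    ∀ f g : Space n → ℝ, IsBandlimited Ω (fun x => (f x : ℂ)) →
      IsBandlimited Ω (fun x => (g x : ℂ)) → (∀ x ∈ b, f x = g x) → f = g

/-- `b` has sampling density `ρ`: the average number of points of `b` per unit volume, over balls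
of radius `a` around any centre, converges to `ρ` as `a → ∞`. -/
def HasSamplingDensity {n : ℕ} (b : Set (Space n)) (ρ : ℝ≥0∞) : Prop :=
  ∀ x : Space n, Tendsto (fun a : ℝ => ((b ∩ Metric.closedBall x a).encard : ℝ≥0∞) /
    volume (Metric.closedBall x a)) atTop (𝓝 ρ)

/-! ### Rotating the line direction to the last axis -/

/-- Omit the last coordinate. -/
def omitLast {n : ℕ} (x : Space (n + 1)) : Space n :=
  WithLp.toLp 2 fun i : Fin n => x i.castSucc

/-- Append a last coordinate equal to `0`. -/
def appendZero {n : ℕ} (s : Space n) : Space (n + 1) :=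
  WithLp.toLp 2 (Fin.snoc (α := fun _ => ℝ) (fun i : Fin n => s i) 0)

/-- `{s ∈ ℝ^n : U⁻¹ (s, 0) ∈ Ω}`. -/
def slice {n : ℕ} (U : Space (n + 1) ≃ₗᵢ[ℝ] Space (n + 1)) (Ω : Set (Space (n + 1))) :
    Set (Space n) :=
  {s | U.symm (appendZero s) ∈ Ω}

/-- The lattice generated by the vectors `U v_1, …, U v_n` with their last coordinates omitted. -/
def projectedLattice {n : ℕ} (U : Space (n + 1) ≃ₗᵢ[ℝ] Space (n + 1))
    (v : Fin (n + 1) → Space (n + 1)) : Set (Space n) :=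
  latticePoints fun i : Fin n => omitLast (U (v i.castSucc))

end

end PathSampling

namespace PathSampling

/-! ### Fourier inversion for bandlimited fields -/

section Inversion

variable {V : Type*} [NormedAddCommGroup V] [InnerProductSpace ℝ V] [FiniteDimensional ℝ V]
  [MeasurableSpace V] [BorelSpace V]

/-! Everything rests on one geometric obstruction: a nonzero `γ` with `⟨γ, w_i⟩ ∈ 2πℤ` for all `i`
and `γ / 2` in the interior of the band. If there is none, the interior of the convex symmetric band
is disjoint from its translates by the dual lattice. The spectrum then embeds in a torus, and
density of trigonometric polynomials gives uniqueness from lattice values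
(`IsBandlimited.eq_zero_of_lattice`). If there is one, opposite bumps at `±γ / 2` are the spectrum
of a nonzero real field vanishing on all hyperplanes `⟨γ, x⟩ ∈ 2πℤ`
(`exists_isBandlimited_vanishing`).

An obstruction for the projected lattice in the slice lifts to one orthogonal to `v_d`; the
hyperplanes it defines contain every line of `P`, so no sampling set on the lines can exist.
Conversely, sampling the lines with a small enough step forces any obstruction in `Ω` to be
orthogonal to `v_d`, so it descends to the slice. The obstructing field is real, which is why real
uniqueness on the slice matches complex uniqueness on `Ω`.

Non-degeneracy always holds: the chords of the ball are traversed row by row, alternately up and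
down (`exists_curve_through_ball`), at an extra cost `o(a^d)`.

For the densities, lattice sums are compared with integrals over translates of a cell. Counting
points and adding chord lengths both give the volume of a ball divided by the volume of the cell, up
to a bounded change of radius; for chords this uses Fubini. -/

theorem continuous_fourierInv {F : V → ℂ} (hF : Integrable F) : Continuous (𝓕⁻ F) := by
  have h : Continuous (𝓕 F) := VectorFourier.fourierIntegral_continuous
    Real.continuous_fourierChar (innerSL ℝ).continuous₂ hF
  have : 𝓕⁻ F = fun x => 𝓕 F (-x) := by
    ext x
    exact Real.fourierInv_eq_fourier_neg F x
  rw [this]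
  exact h.comp continuous_neg

theorem integral_fourierInv_smul {F G : V → ℂ} (hF : Integrable F) (hG : Integrable G) :
    ∫ x, 𝓕⁻ F x • G x = ∫ ξ, F ξ • 𝓕⁻ G ξ := by
  -- The inverse transform is the Fourier integral of the form `-⟨·, ·⟩`; by symmetry of that form,
  -- the same transform appears on both sides of the multiplication formula.
  have hflip : (-innerₗ V).flip = -innerₗ V := by
    ext x y
    simp [real_inner_comm]
  have h := VectorFourier.integral_fourierIntegral_smul_eq_flip (μ := volume) (ν := volume)
    (L := -innerₗ V) Real.continuous_fourierChar
    (innerSL ℝ (E := V)).continuous₂.neg hF hG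
  rw [hflip] at h
  exact h

/-- A continuous square-integrable field whose `L²` Fourier transform is integrable is the
pointwise inverse Fourier integral of that transform. -/
theorem eq_fourierInv_of_integrable {f : V → ℂ} (hc : Continuous f)
    (hf : MemLp f 2 (volume : Measure V))
    (hF : Integrable (𝓕 (hf.toLp f) : Lp ℂ 2 (volume : Measure V))) :
    f = 𝓕⁻ ((𝓕 (hf.toLp f) : Lp ℂ 2 (volume : Measure V)) : V → ℂ) := by
  set F : Lp ℂ 2 (volume : Measure V) := 𝓕 (hf.toLp f) with hFdef
  have hcF : Continuous (𝓕⁻ (F : V → ℂ)) := continuous_fourierInv hF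
  refine (Continuous.ae_eq_iff_eq volume hc hcF).1 ?_
  refine ae_eq_of_integral_contDiff_smul_eq hc.locallyIntegrable hcF.locallyIntegrable ?_
  intro g hg hgc
  have hg₁ : HasCompactSupport (Complex.ofRealCLM ∘ g) := hgc.comp_left rfl
  have hg₂ : ContDiff ℝ (⊤ : ℕ∞) (Complex.ofRealCLM ∘ g) := by fun_prop
  set s : SchwartzMap V ℂ := hg₁.toSchwartzMap hg₂ with hs
  have hsg : ∀ x, s x = (g x : ℂ) := fun x => rfl
  have h1 : ∫ x, g x • f x = Lp.toTemperedDistribution (hf.toLp f) s := by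
    rw [Lp.toTemperedDistribution_apply]
    refine integral_congr_ae ?_
    filter_upwards [hf.coeFn_toLp] with x hx
    rw [hx, hsg, Complex.real_smul, smul_eq_mul]
  have h2 : Lp.toTemperedDistribution (hf.toLp f) s = Lp.toTemperedDistribution F (𝓕⁻ s) := by
    -- Plancherel inversion is compatible with the distributional transform, which by definition
    -- moves `𝓕⁻` onto the test function.
    have : hf.toLp f = 𝓕⁻ F := (FourierTransform.fourierInv_fourier_eq _).symm
    rw [this, ← Lp.fourierInv_toTemperedDistribution_eq]
    rfl
  rw [h1, h2, Lp.toTemperedDistribution_apply]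
  have h3 := integral_fourierInv_smul s.integrable hF
  rw [SchwartzMap.fourierInv_coe, h3]
  refine integral_congr_ae (Eventually.of_forall fun x => ?_)
  simp only [hsg, Complex.real_smul, smul_eq_mul]

theorem integrable_of_memLp_two {F : V → ℂ} (hF : MemLp F 2 (volume : Measure V)) {K : Set V}
    (hK : IsCompact K) (h0 : ∀ᵐ ξ, ξ ∉ K → F ξ = 0) : Integrable F := by
  have : IsFiniteMeasure (volume.restrict K) := ⟨by simpa using hK.measure_lt_top⟩
  have h1 : IntegrableOn F K := (hF.restrict K).integrable (by norm_num)
  have h2 : Integrable (K.indicator F) := h1.integrable_indicator hK.measurableSet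
  refine h2.congr ?_
  filter_upwards [h0] with ξ h
  by_cases hξ : ξ ∈ K
  · simp [hξ]
  · simp [hξ, h hξ]

end Inversion

/-- A square-integrable transform supported in a compact set is integrable, so inversion holds
pointwise and point values on a lattice become integrals against characters. The factor `2π`
converts between the two frequency conventions. -/
theorem IsBandlimited.exists_eq_fourierInv {d : ℕ} {Ω : Set (Space d)} (hΩ : IsCompact Ω)
    {f : Space d → ℂ} (hf : IsBandlimited Ω f) :
    ∃ F : Space d → ℂ, Integrable F ∧ (∀ᵐ ξ, (2 * Real.pi) • ξ ∉ Ω → F ξ = 0) ∧ f = 𝓕⁻ F := by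
  obtain ⟨hc, hL, h0⟩ := hf
  have hpi : (2 * Real.pi) ≠ 0 := by positivity
  set F : Lp ℂ 2 (volume : Measure (Space d)) := 𝓕 (hL.toLp f)
  have h1 : ∀ᵐ ξ : Space d, (2 * Real.pi) • ξ ∉ Ω → F ξ = 0 := by
    have := (Measure.quasiMeasurePreserving_smul (volume : Measure (Space d)) hpi).ae h0
    filter_upwards [this] with ξ hξ
    rwa [smul_smul, inv_mul_cancel₀ hpi, one_smul] at hξ
  have hK : IsCompact {ξ : Space d | (2 * Real.pi) • ξ ∈ Ω} :=
    (Homeomorph.smulOfNeZero (2 * Real.pi) hpi).isCompact_preimage.2 hΩ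
  have hF : Integrable (F : Space d → ℂ) := integrable_of_memLp_two (Lp.memLp F) hK h1
  exact ⟨F, hF, h1, eq_fourierInv_of_integrable hc hL hF⟩

theorem IsBandlimited.sub {d : ℕ} {Ω : Set (Space d)} {f g : Space d → ℂ}
    (hf : IsBandlimited Ω f) (hg : IsBandlimited Ω g) : IsBandlimited Ω (f - g) := by
  obtain ⟨hfc, hfL, hf0⟩ := hf
  obtain ⟨hgc, hgL, hg0⟩ := hg
  refine ⟨hfc.sub hgc, hfL.sub hgL, ?_⟩
  have hpi : (2 * Real.pi)⁻¹ ≠ 0 := by positivity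
  have h : (𝓕 ((hfL.sub hgL).toLp (f - g)) : Lp ℂ 2 (volume : Measure (Space d)))
      = 𝓕 (hfL.toLp f) - 𝓕 (hgL.toLp g) := by
    rw [MemLp.toLp_sub]
    exact map_sub (Lp.fourierTransformₗᵢ (Space d) ℂ) _ _
  have h2 := (Measure.quasiMeasurePreserving_smul (volume : Measure (Space d)) hpi).ae
    (Lp.coeFn_sub (𝓕 (hfL.toLp f) : Lp ℂ 2 (volume : Measure (Space d))) (𝓕 (hgL.toLp g)))
  rw [h]
  filter_upwards [hf0, hg0, h2] with ω h1 h2 h3 hω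
  rw [h3, Pi.sub_apply, h1 hω, h2 hω, sub_zero]

/-! ### Uniqueness from values on a lattice -/

/-- The map `ξ ↦ (⟨w_i, ξ⟩ mod 1)_i` to the torus. -/
noncomputable def toTorus {V ι : Type*} [NormedAddCommGroup V] [InnerProductSpace ℝ V]
    (w : ι → V) (ξ : V) : UnitAddTorus ι :=
  fun i => ((inner ℝ (w i) ξ : ℝ) : UnitAddCircle)

theorem continuous_toTorus {V ι : Type*} [NormedAddCommGroup V] [InnerProductSpace ℝ V]
    (w : ι → V) : Continuous (toTorus w) :=
  continuous_pi fun i => (AddCircle.continuous_mk' 1).comp (by fun_prop)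

/-- Characters of the torus pull back to the exponentials that compute `𝓕⁻` at lattice points. -/
theorem mFourier_toTorus {V ι : Type*} [NormedAddCommGroup V] [InnerProductSpace ℝ V]
    [Fintype ι] (w : ι → V) (m : ι → ℤ) (ξ : V) :
    UnitAddTorus.mFourier m (toTorus w ξ) =
      Complex.exp (↑(2 * Real.pi * inner ℝ ξ (∑ i, (m i : ℝ) • w i)) * Complex.I) := by
  simp only [UnitAddTorus.mFourier, toTorus, ContinuousMap.coe_mk, fourier_coe_apply]
  rw [← Complex.exp_sum, inner_sum]
  congr 1
  push_cast
  rw [Finset.mul_sum, Finset.sum_mul]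
  refine Finset.sum_congr rfl fun i _ => ?_
  rw [inner_smul_right, real_inner_comm]
  push_cast
  ring

section Torus

variable {V ι : Type*} [NormedAddCommGroup V] [InnerProductSpace ℝ V] [FiniteDimensional ℝ V]
  [MeasurableSpace V] [BorelSpace V] [Fintype ι]

/-- The hypothesis kills the functional `g ↦ ∫ (g ∘ toTorus w) F` on characters. It is bounded by
`‖F‖₁` in the sup norm, and the characters span a dense subspace. -/
theorem integral_mul_comp_toTorus_eq_zero {w : ι → V} {F : V → ℂ} (hF : Integrable F)
    (h0 : ∀ m : ι → ℤ, 𝓕⁻ F (∑ i, (m i : ℝ) • w i) = 0) (g : C(UnitAddTorus ι, ℂ)) :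
    ∫ ξ, g (toTorus w ξ) * F ξ = 0 := by
  have hint : ∀ g : C(UnitAddTorus ι, ℂ), Integrable fun ξ => g (toTorus w ξ) * F ξ := fun g =>
    hF.bdd_mul (c := ‖g‖) (g.continuous.comp (continuous_toTorus w)).aestronglyMeasurable
      (Eventually.of_forall fun ξ => g.norm_coe_le_norm _)
  let T : C(UnitAddTorus ι, ℂ) →ₗ[ℂ] ℂ :=
    { toFun := fun g => ∫ ξ, g (toTorus w ξ) * F ξ
      map_add' := fun g₁ g₂ => by
        rw [← integral_add (hint g₁) (hint g₂)]
        exact integral_congr_ae (Eventually.of_forall fun ξ => by simp [add_mul])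
      map_smul' := fun c g => by
        rw [RingHom.id_apply, ← integral_smul]
        exact integral_congr_ae (Eventually.of_forall fun ξ => by simp [mul_assoc]) }
  let T' : C(UnitAddTorus ι, ℂ) →L[ℂ] ℂ := T.mkContinuous (∫ ξ, ‖F ξ‖) fun g => by
    refine (norm_integral_le_integral_norm _).trans ?_
    rw [← integral_mul_const]
    refine integral_mono (hint g).norm (hF.norm.mul_const _) fun ξ => ?_
    simp only [norm_mul]
    rw [mul_comm]
    gcongr
    exact g.norm_coe_le_norm _
  have hker : (Submodule.span ℂ (Set.range (UnitAddTorus.mFourier (d := ι)))).topologicalClosure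
      ≤ LinearMap.ker T'.toLinearMap := by
    refine Submodule.topologicalClosure_minimal _ ?_ T'.isClosed_ker
    rw [Submodule.span_le]
    rintro _ ⟨m, rfl⟩
    change ∫ ξ, UnitAddTorus.mFourier m (toTorus w ξ) * F ξ = 0
    rw [← h0 m, Real.fourierInv_eq']
    exact integral_congr_ae (Eventually.of_forall fun ξ => by
      simp only [mFourier_toTorus, smul_eq_mul])
  rw [UnitAddTorus.span_mFourier_closure_eq_top] at hker
  exact hker (Submodule.mem_top (x := g))

/-- The indicator of a closed set is a pointwise limit of continuous functions with values in `[0,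
1]`, so dominated convergence extends the previous vanishing to it. -/
theorem setIntegral_preimage_toTorus_eq_zero {w : ι → V} {F : V → ℂ} (hF : Integrable F)
    (h0 : ∀ m : ι → ℤ, 𝓕⁻ F (∑ i, (m i : ℝ) • w i) = 0) {C : Set (UnitAddTorus ι)}
    (hC : IsClosed C) : ∫ ξ in toTorus w ⁻¹' C, F ξ = 0 := by
  have hδ : ∀ n : ℕ, 0 < 1 / ((n : ℝ) + 1) := fun n => by positivity
  have hlim := thickenedIndicator_tendsto_indicator_closure hδ
    tendsto_one_div_add_atTop_nhds_zero_nat C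
  rw [hC.closure_eq, tendsto_pi_nhds] at hlim
  have hmeas : MeasurableSet (toTorus w ⁻¹' C) :=
    (hC.preimage (continuous_toTorus w)).measurableSet
  rw [← integral_indicator hmeas]
  have hz : ∀ n : ℕ, ∫ ξ, ((thickenedIndicator (hδ n) C (toTorus w ξ) : ℝ) : ℂ) * F ξ = 0 :=
    fun n => integral_mul_comp_toTorus_eq_zero hF h0
      ⟨fun θ => ((thickenedIndicator (hδ n) C θ : ℝ) : ℂ), by fun_prop⟩
  have ht : Tendsto (fun n : ℕ => ∫ ξ, ((thickenedIndicator (hδ n) C (toTorus w ξ) : ℝ) : ℂ) * F ξ)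
      atTop (𝓝 (∫ ξ, (toTorus w ⁻¹' C).indicator F ξ)) := by
    refine tendsto_integral_of_dominated_convergence (fun ξ => ‖F ξ‖) (fun n => ?_) hF.norm
      (fun n => Eventually.of_forall fun ξ => ?_) (Eventually.of_forall fun ξ => ?_)
    · refine AEStronglyMeasurable.mul (Continuous.aestronglyMeasurable ?_) hF.1
      have := continuous_toTorus w
      fun_prop
    · rw [norm_mul, Complex.norm_real, Real.norm_of_nonneg (NNReal.coe_nonneg _)]
      refine mul_le_of_le_one_left (norm_nonneg _) ?_
      exact_mod_cast thickenedIndicator_le_one (hδ n) C _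
    · have h1 : Tendsto (fun n : ℕ => ((thickenedIndicator (hδ n) C (toTorus w ξ) : ℝ) : ℂ) * F ξ)
          atTop (𝓝 ((((C.indicator (fun _ => 1) (toTorus w ξ) : NNReal) : ℝ) : ℂ) * F ξ)) := by
        refine Tendsto.mul_const _ ?_
        have h2 := (Complex.continuous_ofReal.comp NNReal.continuous_coe).continuousAt.tendsto.comp
          (hlim (toTorus w ξ))
        exact h2
      convert h1 using 2
      by_cases hξ : toTorus w ξ ∈ C <;> simp [Set.indicator, hξ]
  simp only [hz] at ht
  exact (tendsto_nhds_unique ht tendsto_const_nhds)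

/-- An integrable function supported in a bounded open set that meets none of its translates by
the dual lattice vanishes if its inverse Fourier transform vanishes on the lattice. -/
theorem ae_eq_zero_of_fourierInv_eq_zero {w : ι → V} {F : V → ℂ} (hF : Integrable F)
    (h0 : ∀ m : ι → ℤ, 𝓕⁻ F (∑ i, (m i : ℝ) • w i) = 0) {U : Set V} (hU : IsOpen U)
    (hb : Bornology.IsBounded U) (hFU : ∀ᵐ ξ, ξ ∉ U → F ξ = 0)
    (hinj : ∀ ξ ∈ U, ∀ η ∈ U, toTorus w ξ = toTorus w η → ξ = η) : F =ᵐ[volume] 0 := by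
  -- By injectivity on `U`, the preimage of the image of `K` meets `U` only in `K`, and `F` vanishes
  -- off `U`.
  have hK : ∀ K : Set V, IsCompact K → K ⊆ U → ∫ ξ in K, F ξ = 0 := by
    intro K hKc hKU
    have hC : IsClosed (toTorus w '' K) := (hKc.image (continuous_toTorus w)).isClosed
    rw [← setIntegral_preimage_toTorus_eq_zero hF h0 hC]
    have hmeas : MeasurableSet (toTorus w ⁻¹' (toTorus w '' K)) :=
      (hC.preimage (continuous_toTorus w)).measurableSet
    rw [← integral_indicator hmeas, ← integral_indicator hKc.measurableSet]
    refine integral_congr_ae ?_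
    filter_upwards [hFU] with ξ hξ
    by_cases h1 : ξ ∈ K
    · rw [Set.indicator_of_mem h1, Set.indicator_of_mem]
      exact Set.mem_image_of_mem _ h1
    · rw [Set.indicator_of_notMem h1]
      by_cases h2 : ξ ∈ U
      · rw [Set.indicator_of_notMem]
        rintro ⟨η, hη, he⟩
        exact h1 (hinj ξ h2 η (hKU hη) he.symm ▸ hη)
      · simp [Set.indicator, hξ h2]
  -- Exhausting `U` by closed, hence compact, pieces allows the criterion by integrals over compact
  -- sets to be applied on each piece.
  obtain ⟨S, hSc, hSU, hSun, -⟩ := hU.exists_iUnion_isClosed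
  have hS : ∀ n, ∀ᵐ ξ, ξ ∈ S n → F ξ = 0 := by
    intro n
    have hSn : IsCompact (S n) := Metric.isCompact_of_isClosed_isBounded (hSc n)
      (hb.subset (hSU n))
    have : F =ᵐ[volume.restrict (S n)] 0 := by
      refine ae_eq_zero_of_forall_setIntegral_isCompact_eq_zero hF.restrict fun K hKc => ?_
      rw [Measure.restrict_restrict hKc.measurableSet]
      exact hK _ (hKc.inter_right (hSc n)) (Set.inter_subset_right.trans (hSU n))
    exact (ae_restrict_iff' (hSc n).measurableSet).1 this
  filter_upwards [ae_all_iff.2 hS, hFU] with ξ h1 h2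
  by_cases hξ : ξ ∈ U
  · rw [← hSun] at hξ
    obtain ⟨n, hn⟩ := Set.mem_iUnion.1 hξ
    exact h1 n hn
  · exact h2 hξ

end Torus

theorem neg_mem_interior {d : ℕ} {Ω : Set (Space d)} (hsymm : ∀ x ∈ Ω, -x ∈ Ω) {x : Space d}
    (hx : x ∈ interior Ω) : -x ∈ interior Ω := by
  have h : (Homeomorph.neg (Space d)) ⁻¹' Ω = Ω :=
    Set.Subset.antisymm (fun x hx => by simpa using hsymm _ hx) hsymm
  rw [← h, ← Homeomorph.preimage_interior]
  simpa using hx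

/-- Two interior spectral points with the same image in the torus differ by a dual vector `γ`; by
symmetry and convexity the midpoint of one and the negative of the other is `γ / 2`, which is
excluded. -/
theorem IsBandlimited.eq_zero_of_lattice {d : ℕ} {Ω : Set (Space d)} (hΩ : IsCompact Ω)
    (hconv : Convex ℝ Ω) (hsymm : ∀ x ∈ Ω, -x ∈ Ω) {w : Fin d → Space d}
    (hdual : ∀ γ : Space d, γ ≠ 0 → (∀ i, ∃ k : ℤ, inner ℝ γ (w i) = 2 * Real.pi * k) →
      (1 / 2 : ℝ) • γ ∉ interior Ω)
    {f : Space d → ℂ} (hf : IsBandlimited Ω f) (h0 : ∀ x ∈ latticePoints w, f x = 0) : f = 0 := by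
  obtain ⟨F, hF, hFΩ, rfl⟩ := hf.exists_eq_fourierInv hΩ
  have hpi : (2 * Real.pi) ≠ 0 := by positivity
  have hint_symm : ∀ x ∈ interior Ω, -x ∈ interior Ω := fun x hx => neg_mem_interior hsymm hx
  have hq := Measure.quasiMeasurePreserving_smul (volume : Measure (Space d)) hpi
  have hFU : ∀ᵐ ξ : Space d, ξ ∉ (fun ξ : Space d => (2 * Real.pi) • ξ) ⁻¹' interior Ω →
      F ξ = 0 := by
    -- The frontier of a convex set is null, so translates of `Ω` that merely touch are harmless.
    have h1 : ∀ᵐ ξ : Space d, ξ ∉ frontier Ω := by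
      exact measure_eq_zero_iff_ae_notMem.1 (hconv.addHaar_frontier volume)
    filter_upwards [hq.ae h1, hFΩ] with ξ h2 h3 h4
    refine h3 fun h5 => h2 ⟨subset_closure h5, h4⟩
  have hz : F =ᵐ[volume] 0 := by
    refine ae_eq_zero_of_fourierInv_eq_zero (w := w) hF (fun m => h0 _ ⟨m, rfl⟩)
      (isOpen_interior.preimage (continuous_const_smul (2 * Real.pi)))
      ?_ hFU ?_
    · refine ((Homeomorph.smulOfNeZero (2 * Real.pi) hpi).isCompact_preimage.2
        hΩ).isBounded.subset ?_
      exact Set.preimage_mono interior_subset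
    · intro ξ hξ η hη he
      by_contra hne
      refine hdual ((2 * Real.pi) • (ξ - η)) (smul_ne_zero hpi (sub_ne_zero.2 hne)) ?_ ?_
      · intro i
        have := congrFun he i
        simp only [toTorus] at this
        rw [← sub_eq_zero, ← AddCircle.coe_sub, AddCircle.coe_eq_zero_iff] at this
        obtain ⟨k, hk⟩ := this
        refine ⟨k, ?_⟩
        rw [inner_smul_left, inner_sub_left, real_inner_comm, real_inner_comm (w i) η, ← hk]
        simp
      · have := hconv.interior.add_smul_sub_mem hξ (hint_symm _ hη) (t := 1 / 2) (by norm_num)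
        convert this using 1
        module
  ext x
  rw [Real.fourierInv_congr_ae hz]
  simp [Real.fourierInv_eq']

/-! ### Bandlimited fields vanishing on prescribed hyperplanes -/

/-- If `γ / 2` is an interior point of `Ω`, some nonzero real bandlimited field vanishes wherever
`⟨γ, x⟩ ∈ 2πℤ`, as `sin (⟨γ, x⟩ / 2)` does. -/
theorem exists_isBandlimited_vanishing {d : ℕ} {Ω : Set (Space d)} (hsymm : ∀ x ∈ Ω, -x ∈ Ω)
    {γ : Space d} (hγ : γ ≠ 0) (hmem : (1 / 2 : ℝ) • γ ∈ interior Ω) :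
    ∃ f : Space d → ℝ, f ≠ 0 ∧ IsBandlimited Ω (fun x => (f x : ℂ)) ∧
      ∀ x, (∃ k : ℤ, inner ℝ γ x = 2 * Real.pi * k) → f x = 0 := by
  have hpi : (2 * Real.pi) ≠ 0 := by positivity
  set c : Space d := (2 * Real.pi)⁻¹ • (1 / 2 : ℝ) • γ with hc
  have hc0 : c ≠ 0 := by
    rw [hc]
    exact smul_ne_zero (inv_ne_zero hpi) (smul_ne_zero (by norm_num) hγ)
  have hopen : IsOpen ((fun ξ : Space d => (2 * Real.pi) • ξ) ⁻¹' interior Ω) :=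
    isOpen_interior.preimage (continuous_const_smul _)
  have hcmem : c ∈ (fun ξ : Space d => (2 * Real.pi) • ξ) ⁻¹' interior Ω := by
    rw [Set.mem_preimage, hc, smul_smul, mul_inv_cancel₀ hpi, one_smul]
    exact hmem
  obtain ⟨r₀, hr₀, hball⟩ := Metric.isOpen_iff.1 hopen c hcmem
  -- The bound `r₀` keeps the bump in the band; the bound `‖2c‖` makes the bump around `-c` vanish
  -- at `c`, so that `Ψ c = 1`.
  set r : ℝ := min r₀ ‖(2 : ℝ) • c‖ with hr
  have hrpos : 0 < r := lt_min hr₀ (norm_pos_iff.2 (smul_ne_zero two_ne_zero hc0))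
  let ψ : ContDiffBump (0 : Space d) := ⟨r / 2, r, by positivity, by linarith⟩
  have hψ0 : ∀ ξ, r ≤ ‖ξ‖ → ψ ξ = 0 := fun ξ h => ψ.zero_of_le_dist (by simpa using h)
  let Ψ : Space d → ℝ := fun ξ => ψ (ξ - c) - ψ (ξ + c)
  have hΨodd : ∀ ξ, Ψ (-ξ) = -Ψ ξ := by
    intro ξ
    have h1 : -ξ - c = -(ξ + c) := by abel
    have h2 : -ξ + c = -(ξ - c) := by abel
    simp only [Ψ, h1, h2, ψ.neg]
    ring
  have hΨsupp : ∀ ξ, (2 * Real.pi) • ξ ∉ Ω → Ψ ξ = 0 := by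
    have key : ∀ ξ, (2 * Real.pi) • ξ ∉ Ω → ψ (ξ - c) = 0 := by
      intro ξ hξ
      refine hψ0 _ ?_
      by_contra! h
      have : ξ ∈ Metric.ball c r₀ := by
        rw [mem_ball_iff_norm]
        exact h.trans_le (min_le_left _ _)
      exact hξ (interior_subset (hball this))
    intro ξ hξ
    have h1 := key ξ hξ
    have h2 : ψ (ξ + c) = 0 := by
      rw [← ψ.neg, neg_add, ← sub_eq_add_neg]
      refine key (-ξ) fun h => hξ ?_
      have := hsymm _ h
      rwa [smul_neg, neg_neg] at this
    simp only [Ψ, h1, h2, sub_zero]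
  have hΨc : Ψ c = 1 := by
    have h1 : ψ (c - c) = 1 := by
      rw [sub_self]
      exact ψ.one_of_mem_closedBall (Metric.mem_closedBall_self ψ.rIn_pos.le)
    have h2 : ψ (c + c) = 0 := hψ0 _ (by rw [← two_smul ℝ c]; exact min_le_right _ _)
    simp only [Ψ, h1, h2, sub_zero]
  -- An odd real spectrum multiplied by `i` is conjugate-symmetric, so its inverse transform is
  -- real.
  have hΨsmooth : ContDiff ℝ (⊤ : ℕ∞) (fun ξ => Complex.I * (Ψ ξ : ℂ)) := by
    have h1 : ContDiff ℝ (⊤ : ℕ∞) Ψ :=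
      (ψ.contDiff.comp (contDiff_id.sub contDiff_const)).sub
        (ψ.contDiff.comp (contDiff_id.add contDiff_const))
    exact contDiff_const.mul (Complex.ofRealCLM.contDiff.comp h1)
  have hψc : ∀ b : Space d, HasCompactSupport fun ξ => ψ (ξ + b) := fun b =>
    ψ.hasCompactSupport.comp_homeomorph (Homeomorph.addRight b)
  have hΨc_supp : HasCompactSupport (fun ξ => Complex.I * (Ψ ξ : ℂ)) := by
    have h1 : HasCompactSupport Ψ := by
      have := (hψc (-c)).sub (hψc c)
      simp only [← sub_eq_add_neg] at this
      exact this
    exact (h1.comp_left (g := fun y : ℝ => Complex.I * (y : ℂ)) (by simp))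
  let S : SchwartzMap (Space d) ℂ := hΨc_supp.toSchwartzMap hΨsmooth
  have hS : ∀ ξ, S ξ = Complex.I * (Ψ ξ : ℂ) := fun ξ => rfl
  let s : SchwartzMap (Space d) ℂ := 𝓕⁻ S
  have hs : ∀ x, s x = ∫ ξ, Complex.exp (↑(2 * Real.pi * inner ℝ ξ x) * Complex.I) *
      (Complex.I * (Ψ ξ : ℂ)) := by
    intro x
    simp only [s, SchwartzMap.fourierInv_coe, Real.fourierInv_eq', smul_eq_mul, hS]
  have hreal : ∀ x, ((s x).re : ℂ) = s x := by
    intro x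
    refine Complex.conj_eq_iff_re.1 ?_
    rw [hs, ← integral_conj, ← integral_neg_eq_self]
    refine integral_congr_ae (Eventually.of_forall fun ξ => ?_)
    simp only [map_mul, ← Complex.exp_conj, Complex.conj_I, Complex.conj_ofReal, hΨodd,
      inner_neg_left]
    push_cast
    ring_nf
  have hvan : ∀ x, (∃ k : ℤ, inner ℝ γ x = 2 * Real.pi * k) → s x = 0 := by
    rintro x ⟨k, hk⟩
    have hcx : inner ℝ ((2 : ℝ) • c) x = (k : ℝ) := by
      rw [hc]
      simp only [inner_smul_left, hk, RCLike.conj_to_real]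
      field_simp
    let E : Space d → ℂ := fun ξ => Complex.exp (↑(2 * Real.pi * inner ℝ ξ x) * Complex.I)
    -- At such `x` the exponential is `2c`-periodic in frequency, so translating one bump onto the
    -- other cancels the two integrals.
    have hE : ∀ ξ, E (ξ + (2 : ℝ) • c) = E ξ := by
      intro ξ
      simp only [E, inner_add_left, hcx]
      rw [Complex.exp_eq_exp_iff_exists_int]
      refine ⟨k, ?_⟩
      push_cast
      ring
    have hEc : Continuous E := by fun_prop
    have hi : ∀ b : Space d, Integrable fun ξ => E ξ * (Complex.I * (ψ (ξ + b) : ℂ)) := by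
      intro b
      refine Continuous.integrable_of_hasCompactSupport ?_ ?_
      · have := ψ.continuous
        fun_prop
      · exact ((hψc b).comp_left (g := fun y : ℝ => Complex.I * (y : ℂ)) (by simp)).mul_left
    have h1 : s x = (∫ ξ, E ξ * (Complex.I * (ψ (ξ + -c) : ℂ))) -
        ∫ ξ, E ξ * (Complex.I * (ψ (ξ + c) : ℂ)) := by
      rw [hs, ← integral_sub (hi _) (hi _)]
      refine integral_congr_ae (Eventually.of_forall fun ξ => ?_)
      simp only [E, Ψ, sub_eq_add_neg]
      push_cast
      ring
    rw [h1, ← integral_add_right_eq_self _ ((2 : ℝ) • c), sub_eq_zero]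
    refine integral_congr_ae (Eventually.of_forall fun ξ => ?_)
    have h2 : ξ + (2 : ℝ) • c + -c = ξ + c := by module
    simp only [hE, h2]
  have hfun : (fun x => ((s x).re : ℂ)) = s := funext hreal
  refine ⟨fun x => (s x).re, fun h => ?_, ?_, fun x hx => by simp [hvan x hx]⟩
  · have hs0 : s = 0 := by
      ext x
      rw [← hreal x]
      simp [congrFun h x]
    have hS0 : S = 0 := by
      have : 𝓕 s = S := FourierTransform.fourier_fourierInv_eq S
      rw [← this, hs0]
      exact FourierTransform.fourier_zero
    have := hS c
    rw [hS0, hΨc] at this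
    simp [eq_comm] at this
  · rw [hfun]
    refine ⟨s.continuous, s.memLp 2, ?_⟩
    have h1 : (𝓕 ((s.memLp 2).toLp s) : Lp ℂ 2 (volume : Measure (Space d))) = S.toLp 2 := by
      have := SchwartzMap.toLp_fourier_eq s
      rw [FourierTransform.fourier_fourierInv_eq S] at this
      exact this
    rw [h1]
    have hq := Measure.quasiMeasurePreserving_smul (volume : Measure (Space d)) (inv_ne_zero hpi)
    have h2 : ∀ᵐ ξ : Space d, (S.toLp 2 : Lp ℂ 2 (volume : Measure (Space d))) ξ = S ξ := S.coeFn_toLp 2 volume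
    filter_upwards [hq.ae h2] with ω hω hnot
    rw [hω, hS, hΨsupp _ (by rwa [smul_smul, mul_inv_cancel₀ hpi, one_smul])]
    simp

/-! ### Lattices and hyperplane sections -/

theorem isUniformlyDiscrete_latticePoints {d : ℕ} {w : Fin d → Space d}
    (hw : LinearIndependent ℝ w) : IsUniformlyDiscrete (latticePoints w) := by
  obtain ⟨K, hK0, hK⟩ := (Fintype.linearCombination ℝ w).exists_antilipschitzWith
    (LinearMap.ker_eq_bot.2 hw.fintypeLinearCombination_injective)
  have hKpos : (0 : ℝ) < K := NNReal.coe_pos.2 hK0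
  -- Distinct integer vectors are at distance at least 1, giving separation `1 / K`; the factor 2
  -- makes the inequality strict.
  refine ⟨1 / (2 * K), by positivity, ?_⟩
  rintro _ ⟨m, rfl⟩ _ ⟨k, rfl⟩ hne
  obtain ⟨i, hi⟩ : ∃ i, m i ≠ k i := by
    by_contra! h
    exact hne (by simp [h])
  have h1 := hK.le_mul_dist (fun i => (m i : ℝ)) (fun i => (k i : ℝ))
  have h2 : (1 : ℝ) ≤ dist (fun i => (m i : ℝ)) (fun i => (k i : ℝ)) := by
    refine le_trans ?_ (dist_le_pi_dist _ _ i)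
    rw [Real.dist_eq]
    exact_mod_cast Int.one_le_abs (sub_ne_zero.2 hi)
  rw [dist_eq_norm (Fintype.linearCombination ℝ w _)] at h1
  simp only [Fintype.linearCombination_apply] at h1
  rw [div_lt_iff₀ (by positivity)]
  nlinarith

section Slice

variable {n : ℕ}

theorem omitLast_apply (x : Space (n + 1)) (i : Fin n) : omitLast x i = x i.castSucc := rfl

theorem appendZero_castSucc (s : Space n) (i : Fin n) : appendZero s i.castSucc = s i := by
  simp [appendZero]

theorem appendZero_last (s : Space n) : appendZero s (Fin.last n) = 0 := by
  simp [appendZero]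

theorem appendZero_add (s t : Space n) : appendZero (s + t) = appendZero s + appendZero t := by
  ext i
  refine Fin.lastCases ?_ (fun j => ?_) i <;> simp [appendZero_last, appendZero_castSucc]

theorem appendZero_smul (c : ℝ) (s : Space n) : appendZero (c • s) = c • appendZero s := by
  ext i
  refine Fin.lastCases ?_ (fun j => ?_) i <;> simp [appendZero_last, appendZero_castSucc]

theorem inner_appendZero (s : Space n) (x : Space (n + 1)) :
    inner ℝ (appendZero s) x = inner ℝ s (omitLast x) := by
  simp [PiLp.inner_apply, Fin.sum_univ_castSucc, appendZero_last, appendZero_castSucc,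
    omitLast_apply]

theorem appendZero_omitLast {x : Space (n + 1)} (hx : x (Fin.last n) = 0) :
    appendZero (omitLast x) = x := by
  ext i
  refine Fin.lastCases ?_ (fun j => ?_) i
  · simp [appendZero_last, hx]
  · simp [appendZero_castSucc, omitLast_apply]

theorem omitLast_appendZero (s : Space n) : omitLast (appendZero s) = s := by
  ext i
  rw [omitLast_apply, appendZero_castSucc]

variable (U : Space (n + 1) ≃ₗᵢ[ℝ] Space (n + 1))

/-- The linear embedding `s ↦ U⁻¹ (s, 0)`. -/
noncomputable def sliceEmbedding : Space n →ₗ[ℝ] Space (n + 1) where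
  toFun s := U.symm (appendZero s)
  map_add' s t := by rw [appendZero_add, map_add]
  map_smul' c s := by rw [appendZero_smul, map_smul, RingHom.id_apply]

theorem sliceEmbedding_apply (s : Space n) : sliceEmbedding U s = U.symm (appendZero s) := rfl

theorem continuous_sliceEmbedding : Continuous (sliceEmbedding U) :=
  (sliceEmbedding U).continuous_of_finiteDimensional

theorem mem_slice {Ω : Set (Space (n + 1))} {s : Space n} :
    s ∈ slice U Ω ↔ sliceEmbedding U s ∈ Ω := Iff.rfl

theorem inner_sliceEmbedding (s : Space n) (x : Space (n + 1)) :
    inner ℝ (sliceEmbedding U s) x = inner ℝ s (omitLast (U x)) := by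
  rw [← inner_appendZero, sliceEmbedding_apply, ← U.inner_map_map, U.apply_symm_apply]

theorem sliceEmbedding_injective : Function.Injective (sliceEmbedding U) := by
  intro s t h
  have h1 : appendZero s = appendZero t := U.symm.injective h
  rw [← omitLast_appendZero s, h1, omitLast_appendZero]

theorem convex_slice {Ω : Set (Space (n + 1))} (hΩ : Convex ℝ Ω) : Convex ℝ (slice U Ω) :=
  hΩ.linear_preimage (sliceEmbedding U)

theorem neg_mem_slice {Ω : Set (Space (n + 1))} (hΩ : ∀ x ∈ Ω, -x ∈ Ω) :
    ∀ s ∈ slice U Ω, -s ∈ slice U Ω := by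
  intro s hs
  rw [mem_slice, map_neg]
  exact hΩ _ hs

theorem isCompact_slice {Ω : Set (Space (n + 1))} (hΩ : IsCompact Ω) :
    IsCompact (slice U Ω) :=
  ((sliceEmbedding U).isClosedEmbedding_of_injective
    (LinearMap.ker_eq_bot.2 (sliceEmbedding_injective U))).isCompact_preimage hΩ

theorem mem_interior_slice {Ω : Set (Space (n + 1))} {s : Space n}
    (hs : sliceEmbedding U s ∈ interior Ω) : s ∈ interior (slice U Ω) :=
  preimage_interior_subset_interior_preimage (continuous_sliceEmbedding U) hs

theorem zero_mem_interior {d : ℕ} {Ω : Set (Space d)} (hconv : Convex ℝ Ω)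
    (hsymm : ∀ x ∈ Ω, -x ∈ Ω) (hne : (interior Ω).Nonempty) : (0 : Space d) ∈ interior Ω := by
  obtain ⟨x, hx⟩ := hne
  have := hconv.interior.add_smul_sub_mem hx (neg_mem_interior hsymm hx) (t := 1 / 2) (by norm_num)
  convert this using 1
  module

/-- An interior point `s` of the slice can be stretched to `t • s` with `t > 1` without leaving it.
The image of `s` is then a convex combination of a point of `Ω` and the interior point `0`, with
positive weight on `0`. -/
theorem sliceEmbedding_mem_interior {Ω : Set (Space (n + 1))} (hconv : Convex ℝ Ω)
    (h0 : (0 : Space (n + 1)) ∈ interior Ω) {s : Space n} (hs : s ∈ interior (slice U Ω)) :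
    sliceEmbedding U s ∈ interior Ω := by
  have hcont : Tendsto (fun t : ℝ => t • s) (𝓝[>] 1) (𝓝 s) := by
    have : ContinuousAt (fun t : ℝ => t • s) 1 := by fun_prop
    have h := this.tendsto
    rw [one_smul] at h
    exact h.mono_left nhdsWithin_le_nhds
  obtain ⟨t, hts, ht⟩ := ((hcont.eventually (isOpen_interior.mem_nhds hs)).and
    self_mem_nhdsWithin).exists
  have ht1 : (1 : ℝ) < t := ht
  have hmem : t • sliceEmbedding U s ∈ Ω := by
    rw [← map_smul]
    exact (mem_slice U).1 (interior_subset hts)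
  have := hconv.combo_interior_self_mem_interior h0 hmem (a := 1 - t⁻¹) (b := t⁻¹)
    (by rw [sub_pos]; exact inv_lt_one_of_one_lt₀ ht1) (by positivity) (by ring)
  rwa [smul_zero, zero_add, smul_smul, inv_mul_cancel₀ (by positivity), one_smul] at this

end Slice

/-! ### Geometry of a uniform set -/

section Uniform

variable {n : ℕ} {v : Fin (n + 1) → Space (n + 1)}
  {U : Space (n + 1) ≃ₗᵢ[ℝ] Space (n + 1)}

theorem map_apply_last (hU : U (v (Fin.last n)) = EuclideanSpace.single (Fin.last n) 1)
    (x : Space (n + 1)) : U x (Fin.last n) = inner ℝ x (v (Fin.last n)) := by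
  rw [← U.inner_map_map, hU, EuclideanSpace.inner_single_right]
  simp

theorem sliceEmbedding_omitLast (hU : U (v (Fin.last n)) = EuclideanSpace.single (Fin.last n) 1)
    {x : Space (n + 1)} (hx : inner ℝ x (v (Fin.last n)) = 0) :
    sliceEmbedding U (omitLast (U x)) = x := by
  rw [sliceEmbedding_apply, appendZero_omitLast, U.symm_apply_apply]
  rw [map_apply_last hU, hx]

theorem inner_castSucc_last
    (hv_last : ∀ i, inner ℝ (v i) (v (Fin.last n)) = if i = Fin.last n then 1 else 0) (i : Fin n) :
    inner ℝ (v i.castSucc) (v (Fin.last n)) = 0 := by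
  rw [hv_last, if_neg (Fin.castSucc_lt_last i).ne]

theorem norm_last
    (hv_last : ∀ i, inner ℝ (v i) (v (Fin.last n)) = if i = Fin.last n then 1 else 0) :
    ‖v (Fin.last n)‖ = 1 := by
  have := hv_last (Fin.last n)
  rw [if_pos rfl, real_inner_self_eq_norm_sq] at this
  nlinarith [norm_nonneg (v (Fin.last n))]

/-- Since `v_i ⟂ v_d`, nothing is lost on dropping the last coordinate: `sliceEmbedding` recovers
`v_i`. -/
theorem linearIndependent_omitLast (hv : LinearIndependent ℝ v)
    (hv_last : ∀ i, inner ℝ (v i) (v (Fin.last n)) = if i = Fin.last n then 1 else 0)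
    (hU : U (v (Fin.last n)) = EuclideanSpace.single (Fin.last n) 1) :
    LinearIndependent ℝ fun i : Fin n => omitLast (U (v i.castSucc)) := by
  refine LinearIndependent.of_comp (sliceEmbedding U) ?_
  convert hv.comp _ (Fin.castSucc_injective n) using 1
  ext1 i
  exact sliceEmbedding_omitLast hU (inner_castSucc_last hv_last i)

theorem isSamplingLattice_of_isSamplingSet {Ω : Set (Space (n + 1))} (hΩ_compact : IsCompact Ω)
    (hΩ_convex : Convex ℝ Ω) (hΩ_symm : ∀ x ∈ Ω, -x ∈ Ω) (hΩ_int : (interior Ω).Nonempty)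
    (hv : LinearIndependent ℝ v)
    (hv_last : ∀ i, inner ℝ (v i) (v (Fin.last n)) = if i = Fin.last n then 1 else 0)
    (hU : U (v (Fin.last n)) = EuclideanSpace.single (Fin.last n) 1)
    {Λ : Set (Space (n + 1))} (hΛ : Λ ⊆ (uniformSet v).points) (hsamp : IsSamplingSet Ω Λ) :
    IsSamplingLattice (slice U Ω) (projectedLattice U v) := by
  refine ⟨⟨_, linearIndependent_omitLast hv hv_last hU, rfl⟩, fun f g hf hg hfg => ?_⟩
  have hfg0 := (hf.sub hg).eq_zero_of_lattice (isCompact_slice U hΩ_compact)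
    (convex_slice U hΩ_convex) (neg_mem_slice U hΩ_symm)
    (w := fun i : Fin n => omitLast (U (v i.castSucc))) ?_ ?_
  · ext x
    have := congrFun hfg0 x
    rw [Pi.sub_apply, Pi.zero_apply, sub_eq_zero] at this
    exact_mod_cast this
  · intro γ hγ hk hmem
    have h1 := sliceEmbedding_mem_interior U hΩ_convex
      (zero_mem_interior hΩ_convex hΩ_symm hΩ_int) hmem
    rw [map_smul] at h1
    obtain ⟨f₀, hf₀, hband, hvan⟩ := exists_isBandlimited_vanishing hΩ_symm
      (fun h => hγ (sliceEmbedding_injective U (h.trans (map_zero _).symm))) h1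
    refine hf₀ ?_
    -- The zero field is supplied as a difference of a bandlimited field with itself.
    have h2 := hsamp.2 _ _ hband (hband.sub hband) fun x hx => ?_
    · ext x
      have := congrFun h2 x
      simpa using this
    · obtain ⟨m, t, rfl⟩ := hΛ hx
      rw [hvan]
      · simp
      choose k hk using hk
      refine ⟨∑ i, m i * k i, ?_⟩
      -- The lifted `γ` is orthogonal to the lines, so `⟨γ, p_m(t)⟩` does not depend on `t`, and the
      -- field vanishes on whole lines.
      have h3 : inner ℝ (sliceEmbedding U γ) (v (Fin.last n)) = 0 := by
        rw [inner_sliceEmbedding, hU, ← inner_appendZero, EuclideanSpace.inner_single_right,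
          appendZero_last]
        simp
      simp only [uniformSet, inner_add_right, inner_sum, inner_smul_right, h3,
        inner_sliceEmbedding U γ (v (Fin.castSucc _)), hk]
      push_cast
      rw [Finset.mul_sum, mul_zero, add_zero]
      refine Finset.sum_congr rfl fun i _ => ?_
      ring
  · intro x hx
    rw [Pi.sub_apply, hfg x hx, sub_self]

theorem exists_isSamplingSet {Ω : Set (Space (n + 1))} (hΩ_compact : IsCompact Ω)
    (hΩ_convex : Convex ℝ Ω) (hΩ_symm : ∀ x ∈ Ω, -x ∈ Ω)
    (hv : LinearIndependent ℝ v)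
    (hv_last : ∀ i, inner ℝ (v i) (v (Fin.last n)) = if i = Fin.last n then 1 else 0)
    (hU : U (v (Fin.last n)) = EuclideanSpace.single (Fin.last n) 1)
    (hsamp : IsSamplingLattice (slice U Ω) (projectedLattice U v)) :
    ∃ Λ : Set (Space (n + 1)), Λ ⊆ (uniformSet v).points ∧ IsSamplingSet Ω Λ := by
  obtain ⟨R, hR, hΩR⟩ := hΩ_compact.isBounded.exists_pos_norm_le
  have hδ : (R + 1)⁻¹ ≠ 0 := by positivity
  -- The sample points form a lattice: step `1` along `v_1, …, v_n` and step `1 / (R + 1)` along the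
  -- lines, where `R` bounds the norm on `Ω`.
  let c : Fin (n + 1) → ℝˣ := Fin.snoc (α := fun _ => ℝˣ) (fun _ => 1) (Units.mk0 _ hδ)
  have hc₁ : ∀ i : Fin n, c i.castSucc = 1 := fun i => by simp [c]
  have hc₂ : (c (Fin.last n) : ℝ) = (R + 1)⁻¹ := by simp [c]
  have hw : LinearIndependent ℝ (fun i => (c i : ℝ) • v i) := hv.units_smul c
  refine ⟨latticePoints fun i => (c i : ℝ) • v i, ?_, isUniformlyDiscrete_latticePoints hw,
    fun f g hf hg hfg => ?_⟩
  · rintro _ ⟨m, rfl⟩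
    refine ⟨fun i => m i.castSucc, m (Fin.last n) * (R + 1)⁻¹, ?_⟩
    simp only [uniformSet, Fin.sum_univ_castSucc, hc₁, hc₂, Units.val_one, smul_smul, mul_one]
  · rw [← sub_eq_zero]
    refine (hf.sub hg).eq_zero_of_lattice hΩ_compact hΩ_convex hΩ_symm
      (w := fun i => (c i : ℝ) • v i) ?_ fun x hx => by rw [Pi.sub_apply, hfg x hx, sub_self]
    intro γ hγ hk hmem
    have hlast : inner ℝ γ (v (Fin.last n)) = 0 := by
      obtain ⟨k, hk⟩ := hk (Fin.last n)
      rw [inner_smul_right, hc₂] at hk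
      have h1 : |inner ℝ γ (v (Fin.last n))| ≤ 2 * R := by
        have h2 := hΩR _ (interior_subset hmem)
        rw [norm_smul, Real.norm_of_nonneg (by norm_num)] at h2
        have h3 := abs_real_inner_le_norm γ (v (Fin.last n))
        rw [norm_last hv_last] at h3
        linarith
      have hR1 : (R + 1) * (R + 1)⁻¹ = 1 := mul_inv_cancel₀ (by positivity)
      have hk' : inner ℝ γ (v (Fin.last n)) = (R + 1) * (2 * Real.pi * k) := by
        rw [← hk, ← mul_assoc, hR1, one_mul]
      rcases eq_or_ne k 0 with rfl | hk0
      · simpa using hk'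
      -- A nonzero `k` would give `|⟨γ, v_d⟩| ≥ 2π(R + 1)`, exceeding the bound `2R` that follows
      -- from `γ / 2 ∈ Ω`.
      · exfalso
        have h4 : (1 : ℝ) ≤ |(k : ℝ)| := by exact_mod_cast Int.one_le_abs hk0
        rw [hk', abs_mul, abs_mul, abs_of_pos (by positivity : 0 < R + 1),
          abs_of_pos (by positivity : 0 < 2 * Real.pi)] at h1
        nlinarith [Real.pi_gt_three, mul_le_mul_of_nonneg_left h4 Real.pi_pos.le]
    set s := omitLast (U γ) with hs
    have hγs : sliceEmbedding U s = γ := sliceEmbedding_omitLast hU hlast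
    have hs0 : s ≠ 0 := by
      intro h
      rw [h, map_zero] at hγs
      exact hγ hγs.symm
    have hsmem : (1 / 2 : ℝ) • s ∈ interior (slice U Ω) := by
      refine mem_interior_slice U ?_
      rwa [map_smul, hγs]
    obtain ⟨f₀, hf₀, hband, hvan⟩ := exists_isBandlimited_vanishing (neg_mem_slice U hΩ_symm)
      hs0 hsmem
    have hband0 : IsBandlimited (slice U Ω) fun x => (((0 : Space n → ℝ) x : ℝ) : ℂ) := by
      convert hband.sub hband using 1
      ext x
      simp
    refine hf₀ (hsamp.2 f₀ 0 hband hband0 ?_)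
    rintro _ ⟨m, rfl⟩
    refine hvan _ ?_
    choose k hk using hk
    refine ⟨∑ i : Fin n, m i * k i.castSucc, ?_⟩
    rw [inner_sum]
    push_cast
    rw [Finset.mul_sum]
    refine Finset.sum_congr rfl fun i _ => ?_
    have := hk i.castSucc
    rw [hc₁, Units.val_one, one_smul, ← hγs, inner_sliceEmbedding] at this
    rw [inner_smul_right, this]
    ring

end Uniform

/-! ### Rectifiable curves through given sets -/

section Curves

/-- A continuous curve of length at most `L` from `p` to `q` passes through all points of `S`. -/
def CoveredByCurve {E : Type*} [NormedAddCommGroup E] (p q : E) (L : ℝ≥0∞) (S : Set E) : Prop :=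
  ∃ γ : ℝ → E, ContinuousOn γ (Set.Icc 0 1) ∧ γ 0 = p ∧ γ 1 = q ∧
    eVariationOn γ (Set.Icc 0 1) ≤ L ∧ S ⊆ γ '' Set.Icc 0 1

theorem CoveredByCurve.mono {E : Type*} [NormedAddCommGroup E] {p q : E} {L L' : ℝ≥0∞} {S S' : Set E} 
    (h : CoveredByCurve p q L S) (hL : L ≤ L') (hS : S' ⊆ S) : CoveredByCurve p q L' S' := by
  obtain ⟨γ, h1, h2, h3, h4, h5⟩ := h
  exact ⟨γ, h1, h2, h3, h4.trans hL, hS.trans h5⟩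

variable {E : Type*} [NormedAddCommGroup E] [NormedSpace ℝ E]

theorem coveredByCurve_segment (p q : E) :
    CoveredByCurve p q (edist p q) (segment ℝ p q) := by
  refine ⟨fun t => AffineMap.lineMap p q t, AffineMap.lineMap_continuous.continuousOn,
    AffineMap.lineMap_apply_zero p q, AffineMap.lineMap_apply_one p q, ?_, ?_⟩
  · have h := (lipschitzWith_lineMap (𝕜 := ℝ) p q).lipschitzOnWith (s := Set.Icc (0 : ℝ) 1)
      |>.comp_eVariationOn_le (g := id) (Set.mapsTo_id _)
    rw [eVariationOn_id_Icc] at h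
    rw [sub_zero, ENNReal.ofReal_one, mul_one] at h
    rw [edist_nndist]
    exact h
  · rw [segment_eq_image_lineMap]

theorem CoveredByCurve.trans {E : Type*} [NormedAddCommGroup E] {p q r : E} {L L' : ℝ≥0∞}
    {S S' : Set E}
    (h : CoveredByCurve p q L S) (h' : CoveredByCurve q r L' S') :
    CoveredByCurve p r (L + L') (S ∪ S') := by
  obtain ⟨γ, hc, h0, h1, hL, hS⟩ := h
  obtain ⟨γ', hc', h0', h1', hL', hS'⟩ := h'
  let δ : ℝ → E := fun t => if t ≤ 1 / 2 then γ (2 * t) else γ' (2 * t - 1)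
  have hu : Set.Icc (0 : ℝ) 1 = Set.Icc 0 (1 / 2) ∪ Set.Icc (1 / 2) 1 :=
    (Set.Icc_union_Icc_eq_Icc (by norm_num) (by norm_num)).symm
  have e1 : Set.EqOn δ (γ ∘ fun t => 2 * t) (Set.Icc 0 (1 / 2)) := fun t ht => if_pos ht.2
  have e2 : Set.EqOn δ (γ' ∘ fun t => 2 * t - 1) (Set.Icc (1 / 2) 1) := by
    intro t ht
    rcases ht.1.eq_or_lt with rfl | hlt
    · simp [δ, h1, h0']
    · exact if_neg (not_le.2 hlt)
  have m1 : Set.MapsTo (fun t : ℝ => 2 * t) (Set.Icc 0 (1 / 2)) (Set.Icc 0 1) := by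
    intro t ht
    constructor <;> linarith [ht.1, ht.2]
  have m2 : Set.MapsTo (fun t : ℝ => 2 * t - 1) (Set.Icc (1 / 2) 1) (Set.Icc 0 1) := by
    intro t ht
    constructor <;> linarith [ht.1, ht.2]
  refine ⟨δ, ?_, ?_, ?_, ?_, ?_⟩
  · rw [hu]
    refine ContinuousOn.union_of_isClosed ?_ ?_ isClosed_Icc isClosed_Icc
    · exact (hc.comp (by fun_prop) m1).congr e1
    · exact (hc'.comp (by fun_prop) m2).congr e2
  · simp [δ, h0]
  · have : ¬ ((1 : ℝ) ≤ 1 / 2) := by norm_num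
    simp only [δ, if_neg this]
    norm_num [h1']
  · rw [hu, eVariationOn.union δ (isGreatest_Icc (by norm_num)) (isLeast_Icc (by norm_num)),
      eVariationOn.eq_of_eqOn e1, eVariationOn.eq_of_eqOn e2]
    refine add_le_add ((eVariationOn.comp_le_of_monotoneOn γ _ ?_ m1).trans hL)
      ((eVariationOn.comp_le_of_monotoneOn γ' _ ?_ m2).trans hL')
    · exact fun a _ b _ hab => by linarith
    · exact fun a _ b _ hab => by linarith
  · rintro y (hy | hy)
    · obtain ⟨t, ht, rfl⟩ := hS hy
      refine ⟨t / 2, ⟨by linarith [ht.1], by linarith [ht.2]⟩, ?_⟩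
      rw [e1 ⟨by linarith [ht.1], by linarith [ht.2]⟩]
      simp [mul_div_cancel₀]
    · obtain ⟨t, ht, rfl⟩ := hS' hy
      refine ⟨(t + 1) / 2, ⟨by linarith [ht.1], by linarith [ht.2]⟩, ?_⟩
      rw [e2 ⟨by linarith [ht.1], by linarith [ht.2]⟩]
      simp [mul_div_cancel₀]

theorem CoveredByCurve.trans_segment {p q r : E} {L d : ℝ≥0∞} {S : Set E}
    (h : CoveredByCurve p q L S) (hd : edist q r ≤ d) : CoveredByCurve p r (L + d) S :=
  (h.trans (coveredByCurve_segment q r)).mono (by gcongr) Set.subset_union_left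

/-- Consecutive segments with nearby end points, traversed alternately up and down. -/
theorem exists_coveredByCurve_snake (b t : ℕ → E) (δ : ℝ≥0∞) (N : ℕ)
    (hb : ∀ k < N, edist (b k) (b (k + 1)) ≤ δ) (ht : ∀ k < N, edist (t k) (t (k + 1)) ≤ δ) :
    ∃ q, (q = b N ∨ q = t N) ∧
      CoveredByCurve (b 0) q (∑ k ∈ Finset.range (N + 1), edist (b k) (t k) + N * δ)
        (⋃ k ∈ Finset.range (N + 1), segment ℝ (b k) (t k)) := by
  induction N with
  | zero =>
    refine ⟨t 0, Or.inr rfl, (coveredByCurve_segment (b 0) (t 0)).mono ?_ ?_⟩ <;> simp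
  | succ N ih =>
    obtain ⟨q, hq, hcov⟩ := ih (fun k hk => hb k (by omega)) (fun k hk => ht k (by omega))
    have hL : ∑ k ∈ Finset.range (N + 1), edist (b k) (t k) + N * δ + δ +
        edist (b (N + 1)) (t (N + 1)) ≤
        ∑ k ∈ Finset.range (N + 1 + 1), edist (b k) (t k) + ((N + 1 : ℕ) : ℝ≥0∞) * δ := by
      rw [Finset.sum_range_succ _ (N + 1)]
      push_cast
      exact le_of_eq (by ring)
    have hS : (⋃ k ∈ Finset.range (N + 1 + 1), segment ℝ (b k) (t k)) ⊆
        (⋃ k ∈ Finset.range (N + 1), segment ℝ (b k) (t k)) ∪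
          segment ℝ (b (N + 1)) (t (N + 1)) := by
      rw [Finset.range_add_one (n := N + 1), Finset.set_biUnion_insert, Set.union_comm]
    rcases hq with rfl | rfl
    · exact ⟨t (N + 1), Or.inr rfl, ((hcov.trans_segment (hb N (by omega))).trans
        (coveredByCurve_segment _ _)).mono hL hS⟩
    · refine ⟨b (N + 1), Or.inl rfl, ((hcov.trans_segment (ht N (by omega))).trans
        (coveredByCurve_segment _ _)).mono (le_trans (le_of_eq ?_) hL) ?_⟩
      · rw [edist_comm (t (N + 1))]
      · rwa [segment_symm ℝ (t (N + 1))]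

/-- Curves whose end points lie in a common set of diameter at most `D` can be joined. -/
theorem exists_coveredByCurve_biUnion {ι : Type*} [DecidableEq ι] (R : Finset ι)
    (L : ι → ℝ≥0∞) (D : ℝ≥0∞) (S : ι → Set E) (X : Set E)
    (hX : ∀ p ∈ X, ∀ q ∈ X, edist p q ≤ D) (hne : X.Nonempty)
    (h : ∀ r ∈ R, ∃ p ∈ X, ∃ q ∈ X, CoveredByCurve p q (L r) (S r)) :
    ∃ p ∈ X, ∃ q ∈ X, CoveredByCurve p q (∑ r ∈ R, (L r + D)) (⋃ r ∈ R, S r) := by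
  induction R using Finset.induction_on with
  | empty =>
    obtain ⟨p, hp⟩ := hne
    exact ⟨p, hp, p, hp, (coveredByCurve_segment p p).mono (by simp) (by simp)⟩
  | insert r R hr ih =>
    obtain ⟨p, hp, q, hq, hpq⟩ := ih fun r' hr' => h r' (Finset.mem_insert_of_mem hr')
    obtain ⟨p', hp', q', hq', hpq'⟩ := h r (Finset.mem_insert_self _ _)
    refine ⟨p, hp, q', hq', ((hpq.trans_segment (hX q hq p' hp')).trans hpq').mono ?_ ?_⟩
    · rw [Finset.sum_insert hr]
      exact le_of_eq (by ring)
    · rw [Finset.set_biUnion_insert, Set.union_comm]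

end Curves

/-! ### Arc length of a uniform set -/

section ArcLength

variable {n : ℕ} {v : Fin (n + 1) → Space (n + 1)}
  {U : Space (n + 1) ≃ₗᵢ[ℝ] Space (n + 1)}

theorem norm_sq_sliceEmbedding_add
    (hU : U (v (Fin.last n)) = EuclideanSpace.single (Fin.last n) 1) (y : Space n) (t : ℝ) :
    ‖sliceEmbedding U y + t • v (Fin.last n)‖ ^ 2 = ‖y‖ ^ 2 + t ^ 2 := by
  have h1 : ‖sliceEmbedding U y + t • v (Fin.last n)‖ =
      ‖appendZero y + t • EuclideanSpace.single (Fin.last n) (1 : ℝ)‖ := by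
    rw [← U.norm_map, map_add, map_smul, hU, sliceEmbedding_apply, U.apply_symm_apply]
  rw [h1, EuclideanSpace.norm_sq_eq, EuclideanSpace.norm_sq_eq, Fin.sum_univ_castSucc]
  simp [appendZero_castSucc, appendZero_last]

theorem norm_sq_sub_sliceEmbedding_add
    (hU : U (v (Fin.last n)) = EuclideanSpace.single (Fin.last n) 1) (y y' : Space n)
    (t t' : ℝ) :
    ‖(sliceEmbedding U y + t • v (Fin.last n)) - (sliceEmbedding U y' + t' • v (Fin.last n))‖ ^ 2 =
      ‖y - y'‖ ^ 2 + (t - t') ^ 2 := by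
  rw [← norm_sq_sliceEmbedding_add hU, map_sub, sub_smul]
  congr 2
  abel

theorem norm_sub_sliceEmbedding_add_le
    (hU : U (v (Fin.last n)) = EuclideanSpace.single (Fin.last n) 1) (y y' : Space n)
    (t t' : ℝ) :
    ‖(sliceEmbedding U y + t • v (Fin.last n)) - (sliceEmbedding U y' + t' • v (Fin.last n))‖ ≤
      ‖y - y'‖ + |t - t'| := by
  refine abs_le_of_sq_le_sq' ?_ (by positivity) |>.2
  rw [norm_sq_sub_sliceEmbedding_add hU, ← sq_abs (t - t')]
  nlinarith [norm_nonneg (y - y'), abs_nonneg (t - t'),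
    mul_nonneg (norm_nonneg (y - y')) (abs_nonneg (t - t'))]

theorem sliceEmbedding_add_eq_self
    (hU : U (v (Fin.last n)) = EuclideanSpace.single (Fin.last n) 1) (x : Space (n + 1)) :
    sliceEmbedding U (omitLast (U x)) + U x (Fin.last n) • v (Fin.last n) = x := by
  apply U.injective
  rw [map_add, map_smul, hU, sliceEmbedding_apply, U.apply_symm_apply]
  ext i
  refine Fin.lastCases ?_ (fun j => ?_) i
  · simp [appendZero_last]
  · simp [appendZero_castSucc, omitLast_apply]

/-- The points of the projected lattice, with their coordinates. -/
noncomputable def projectedPoint (U : Space (n + 1) ≃ₗᵢ[ℝ] Space (n + 1))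
    (v : Fin (n + 1) → Space (n + 1)) (m : Fin n → ℤ) : Space n :=
  ∑ i, (m i : ℝ) • omitLast (U (v i.castSucc))

theorem uniformSet_path (hv_last : ∀ i, inner ℝ (v i) (v (Fin.last n)) =
      if i = Fin.last n then 1 else 0)
    (hU : U (v (Fin.last n)) = EuclideanSpace.single (Fin.last n) 1) (m : Fin n → ℤ) (t : ℝ) :
    (uniformSet v).path m t = sliceEmbedding U (projectedPoint U v m) + t • v (Fin.last n) := by
  simp only [uniformSet, projectedPoint, map_sum, map_smul]
  congr 1
  exact Finset.sum_congr rfl fun i _ => by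
    rw [sliceEmbedding_omitLast hU (inner_castSucc_last hv_last i)]

theorem norm_path_sub_le_iff (hv_last : ∀ i, inner ℝ (v i) (v (Fin.last n)) =
      if i = Fin.last n then 1 else 0)
    (hU : U (v (Fin.last n)) = EuclideanSpace.single (Fin.last n) 1) (m : Fin n → ℤ) (t : ℝ)
    {a : ℝ} (ha : 0 ≤ a) (x : Space (n + 1)) :
    ‖(uniformSet v).path m t - x‖ ≤ a ↔
      ‖projectedPoint U v m - omitLast (U x)‖ ^ 2 + (t - U x (Fin.last n)) ^ 2 ≤ a ^ 2 := by
  rw [← norm_sq_sub_sliceEmbedding_add hU, sliceEmbedding_add_eq_self hU,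
    ← uniformSet_path hv_last hU, sq_le_sq₀ (norm_nonneg _) ha]

/-- Since `√` is zero on negative numbers, the formula also covers lines that miss the ball. -/
theorem volume_setOf_sq_le (q τ : ℝ) :
    volume {t : ℝ | q + (t - τ) ^ 2 ≤ 0} = ENNReal.ofReal (2 * √(-q)) := by
  rcases le_or_gt q 0 with hq | hq
  · have : {t : ℝ | q + (t - τ) ^ 2 ≤ 0} = Set.Icc (τ - √(-q)) (τ + √(-q)) := by
      ext t
      have h1 : q + (t - τ) ^ 2 ≤ 0 ↔ |t - τ| ≤ √(-q) := by
        rw [← Real.sqrt_sq_eq_abs, Real.sqrt_le_sqrt_iff (by linarith)]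
        constructor <;> intro h <;> linarith
      rw [Set.mem_ofPred_eq, h1, abs_le, Set.mem_Icc]
      constructor <;> rintro ⟨h, h'⟩ <;> constructor <;> linarith
    rw [this, Real.volume_Icc]
    congr 1
    ring
  · have : {t : ℝ | q + (t - τ) ^ 2 ≤ 0} = ∅ := by
      ext t
      simp only [Set.mem_ofPred_eq, Set.mem_empty_iff_false, iff_false, not_le]
      positivity
    rw [this, Real.sqrt_eq_zero_of_nonpos (by linarith)]
    simp

theorem arcLengthIn_eq_tsum_volume (hv_last : ∀ i, inner ℝ (v i) (v (Fin.last n)) =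
      if i = Fin.last n then 1 else 0) (a : ℝ) (x : Space (n + 1)) :
    (uniformSet v).arcLengthIn a x =
      ∑' m : Fin n → ℤ, volume {t : ℝ | ‖(uniformSet v).path m t - x‖ ≤ a} := by
  refine tsum_congr fun m => ?_
  have hd : ∀ t, deriv ((uniformSet v).path m) t = v (Fin.last n) := by
    intro t
    have : HasDerivAt (fun t : ℝ => ∑ i : Fin n, (m i : ℝ) • v i.castSucc + t • v (Fin.last n))
        ((1 : ℝ) • v (Fin.last n)) t :=
      ((hasDerivAt_id t).smul_const (v (Fin.last n))).const_add _
    rw [one_smul] at this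
    exact this.deriv
  have he : ‖v (Fin.last n)‖ₑ = 1 := by
    rw [← ofReal_norm, norm_last hv_last, ENNReal.ofReal_one]
  simp only [hd, he]
  rw [setLIntegral_one]

theorem arcLengthIn_eq_tsum (hv_last : ∀ i, inner ℝ (v i) (v (Fin.last n)) =
      if i = Fin.last n then 1 else 0)
    (hU : U (v (Fin.last n)) = EuclideanSpace.single (Fin.last n) 1)
    {a : ℝ} (ha : 0 ≤ a) (x : Space (n + 1)) :
    (uniformSet v).arcLengthIn a x = ∑' m : Fin n → ℤ,
      ENNReal.ofReal (2 * √(a ^ 2 - ‖projectedPoint U v m - omitLast (U x)‖ ^ 2)) := by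
  rw [arcLengthIn_eq_tsum_volume hv_last]
  refine tsum_congr fun m => ?_
  rw [← neg_sub (‖projectedPoint U v m - omitLast (U x)‖ ^ 2), ← volume_setOf_sq_le _
    (U x (Fin.last n))]
  congr 1
  ext t
  rw [Set.mem_ofPred_eq, Set.mem_ofPred_eq, norm_path_sub_le_iff hv_last hU m t ha]
  constructor <;> intro h <;> linarith

end ArcLength

/-! ### Uniform sets are non-degenerate -/

/-- Signs are unrestricted because neighbouring lines may lie on either side of the boundary of the
ball. -/
theorem abs_sqrt_sub_sqrt_le (x y : ℝ) : |√x - √y| ≤ √|x - y| := by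
  have key : ∀ x y : ℝ, √x - √y ≤ √|x - y| := by
    intro x y
    rw [sub_le_iff_le_add]
    refine Real.sqrt_le_iff.2 ⟨by positivity, ?_⟩
    have h1 : |x - y| = √|x - y| ^ 2 := (Real.sq_sqrt (abs_nonneg _)).symm
    have h2 : y ≤ √y ^ 2 := by
      rcases le_or_gt 0 y with h | h
      · exact (Real.sq_sqrt h).ge
      · exact h.le.trans (sq_nonneg _)
    have h3 := le_abs_self (x - y)
    have h4 : 0 ≤ √|x - y| * √y := by positivity
    nlinarith
  rw [abs_le]
  constructor
  · have := key y x
    rw [abs_sub_comm] at this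
    linarith
  · exact key x y

theorem isLittleO_sqrt_id : (fun a : ℝ => √a) =o[atTop] fun a => a := by
  refine Asymptotics.isLittleO_of_tendsto' ?_ ?_
  · filter_upwards [eventually_gt_atTop 0] with a ha h
    exact absurd h ha.ne'
  · simp only [Real.sqrt_div_self']
    exact tendsto_const_nhds.div_atTop Real.tendsto_sqrt_atTop

section Nondegenerate

variable {k : ℕ} {v : Fin (k + 2) → Space (k + 2)}
  {U : Space (k + 2) ≃ₗᵢ[ℝ] Space (k + 2)}

theorem projectedPoint_cons (j : ℤ) (r : Fin k → ℤ) :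
    projectedPoint U v (Fin.cons j r) = (j : ℝ) • omitLast (U (v (Fin.castSucc 0))) +
      ∑ i : Fin k, (r i : ℝ) • omitLast (U (v i.succ.castSucc)) := by
  rw [projectedPoint, Fin.sum_univ_succ]
  simp

/-- Confines the indices of the lines meeting a ball of radius `a` to a box of side `O(a)`. -/
theorem exists_abs_le_mul_norm_projectedPoint {n : ℕ} {v : Fin (n + 1) → Space (n + 1)}
    {U : Space (n + 1) ≃ₗᵢ[ℝ] Space (n + 1)}
    (hw : LinearIndependent ℝ fun i : Fin n => omitLast (U (v i.castSucc))) :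
    ∃ C : ℝ, 0 < C ∧ ∀ (m : Fin n → ℤ) (i : Fin n), |(m i : ℝ)| ≤ C * ‖projectedPoint U v m‖ := by
  obtain ⟨K, hK0, hK⟩ := (Fintype.linearCombination ℝ
    fun i : Fin n => omitLast (U (v i.castSucc))).exists_antilipschitzWith
    (LinearMap.ker_eq_bot.2 hw.fintypeLinearCombination_injective)
  refine ⟨K, NNReal.coe_pos.2 hK0, fun m i => ?_⟩
  have h1 := hK.le_mul_dist (fun i => (m i : ℝ)) 0
  rw [dist_zero_right, map_zero, dist_zero_right] at h1
  exact (norm_le_pi_norm (fun i => (m i : ℝ)) i).trans h1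

/-- The indices form a box `[-K, K]^(k+1)`, split into `(2K + 1)^k` rows along the first coordinate.
Each row of chords is a snake with `2K` connections of length at most `W + √(2MW)`, and joining
consecutive rows costs at most `2(M + a)`. Here `W` bounds a step between neighbouring lines, and
`M` the distance of the lines in the box from the centre. -/
theorem exists_curve_through_ball (hv_last : ∀ i, inner ℝ (v i) (v (Fin.last (k + 1))) =
      if i = Fin.last (k + 1) then 1 else 0)
    (hU : U (v (Fin.last (k + 1))) = EuclideanSpace.single (Fin.last (k + 1)) 1)
    {C : ℝ} (hC : ∀ (m : Fin (k + 1) → ℤ) (i : Fin (k + 1)),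
      |(m i : ℝ)| ≤ C * ‖projectedPoint U v m‖) (hC0 : 0 < C)
    (x : Space (k + 2)) {a : ℝ} (ha : 0 ≤ a) {K : ℕ} {W M : ℝ}
    (hW : ∑ i : Fin (k + 1), ‖omitLast (U (v i.castSucc))‖ ≤ W)
    (hK : C * (a + ‖omitLast (U x)‖) ≤ K) (hM : K * W + ‖omitLast (U x)‖ ≤ M) :
    ∃ γ : ℝ → Space (k + 2), ContinuousOn γ (Set.Icc 0 1) ∧
      eVariationOn γ (Set.Icc 0 1) ≤ (uniformSet v).arcLengthIn a x +
        ENNReal.ofReal ((2 * K + 1) ^ k * (2 * K * (W + √(2 * M * W)) + 2 * (M + a))) ∧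
      (uniformSet v).points ∩ Metric.closedBall x a ⊆ γ '' Set.Icc 0 1 := by
  set e := v (Fin.last (k + 1)) with he
  set x' := omitLast (U x) with hx'
  set τ := U x (Fin.last (k + 1)) with hτ
  set lat := projectedPoint U v with hlat
  have hW0 : 0 ≤ W := le_trans (Finset.sum_nonneg fun _ _ => norm_nonneg _) hW
  have hM0 : 0 ≤ M := le_trans (by positivity) hM
  -- Half the chord length; for a line missing the ball it is `0` and the chord degenerates to a
  -- point, so whole rows can be used.
  let s : (Fin (k + 1) → ℤ) → ℝ := fun m => √(a ^ 2 - ‖lat m - x'‖ ^ 2)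
  let pt : Space (k + 1) → ℝ → Space (k + 2) := fun y t => sliceEmbedding U y + t • e
  have hpt : ∀ y y' t t', ‖pt y t - pt y' t'‖ ≤ ‖y - y'‖ + |t - t'| :=
    norm_sub_sliceEmbedding_add_le hU
  have hxpt : pt x' τ = x := sliceEmbedding_add_eq_self hU x
  let box : Set (Fin (k + 1) → ℤ) := {m | ∀ i, |(m i : ℝ)| ≤ K}
  have hbox : ∀ m ∈ box, ‖lat m - x'‖ ≤ M := by
    intro m hm
    refine (norm_sub_le _ _).trans (le_trans ?_ hM)
    gcongr
    calc ‖lat m‖ ≤ ∑ i, ‖(m i : ℝ) • omitLast (U (v i.castSucc))‖ := norm_sum_le _ _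
      _ ≤ ∑ i : Fin (k + 1), K * ‖omitLast (U (v i.castSucc))‖ := by
        refine Finset.sum_le_sum fun i _ => ?_
        rw [norm_smul, Real.norm_eq_abs]
        gcongr
        exact hm i
      _ ≤ K * W := by
        rw [← Finset.mul_sum]
        gcongr
  have hs0 : ∀ m, 0 ≤ s m := fun m => Real.sqrt_nonneg _
  have hsa : ∀ m, s m ≤ a := fun m =>
    (Real.sqrt_le_left ha).2 (by nlinarith [sq_nonneg ‖lat m - x'‖])
  have hstep : ∀ m ∈ box, ∀ m' ∈ box, ‖lat m - lat m'‖ ≤ W →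
      |s m - s m'| ≤ √(2 * M * W) := by
    intro m hm m' hm' hmm
    refine (abs_sqrt_sub_sqrt_le _ _).trans (Real.sqrt_le_sqrt ?_)
    -- The difference of squares is at most `W · 2M`, the source of `√(2MW)`.
    have h1 : a ^ 2 - ‖lat m - x'‖ ^ 2 - (a ^ 2 - ‖lat m' - x'‖ ^ 2) =
        (‖lat m' - x'‖ - ‖lat m - x'‖) * (‖lat m' - x'‖ + ‖lat m - x'‖) := by ring
    have h2 : |‖lat m' - x'‖ - ‖lat m - x'‖| ≤ W := by
      refine (abs_norm_sub_norm_le _ _).trans ?_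
      rwa [sub_sub_sub_cancel_right, norm_sub_rev]
    rw [h1, abs_mul, abs_of_nonneg (by positivity : 0 ≤ ‖lat m' - x'‖ + ‖lat m - x'‖)]
    calc _ ≤ W * (M + M) := by
          gcongr
          · exact hbox m' hm'
          · exact hbox m hm
      _ = 2 * M * W := by ring
  let row : (Fin k → ℤ) → ℕ → (Fin (k + 1) → ℤ) := fun r i => Fin.cons ((i : ℤ) - K) r
  let R : Finset (Fin k → ℤ) := Fintype.piFinset fun _ => Finset.Icc (-(K : ℤ)) K
  have hrow : ∀ r ∈ R, ∀ i < 2 * K + 1, row r i ∈ box := by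
    intro r hr i hi j
    refine Fin.cases ?_ (fun j => ?_) j
    · simp only [row, Fin.cons_zero]
      rw [abs_le]
      have : (i : ℝ) ≤ 2 * K := by exact_mod_cast (by omega : i ≤ 2 * K)
      push_cast
      constructor <;> linarith [(Nat.cast_nonneg i : (0 : ℝ) ≤ i)]
    · simp only [row, Fin.cons_succ]
      have := Finset.mem_Icc.1 (Fintype.mem_piFinset.1 hr j)
      rw [abs_le]
      exact ⟨by exact_mod_cast this.1, by exact_mod_cast this.2⟩
  have hrowstep : ∀ r i, ‖lat (row r i) - lat (row r (i + 1))‖ ≤ W := by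
    intro r i
    have : lat (row r i) - lat (row r (i + 1)) = -omitLast (U (v (Fin.castSucc 0))) := by
      simp only [row, hlat, projectedPoint_cons]
      push_cast
      module
    rw [this, norm_neg]
    refine le_trans ?_ hW
    exact Finset.single_le_sum (f := fun i : Fin (k + 1) => ‖omitLast (U (v i.castSucc))‖)
      (fun _ _ => norm_nonneg _) (Finset.mem_univ 0)
  let bot : (Fin (k + 1) → ℤ) → Space (k + 2) := fun m => pt (lat m) (τ - s m)
  let top : (Fin (k + 1) → ℤ) → Space (k + 2) := fun m => pt (lat m) (τ + s m)
  let X : Set (Space (k + 2)) := Metric.closedBall x (M + a)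
  have hbotX : ∀ m ∈ box, bot m ∈ X := by
    intro m hm
    rw [Metric.mem_closedBall, dist_eq_norm, ← hxpt]
    refine (hpt _ _ _ _).trans (add_le_add (hbox m hm) ?_)
    rw [sub_sub_cancel_left, abs_neg, abs_of_nonneg (hs0 m)]
    exact hsa m
  have htopX : ∀ m ∈ box, top m ∈ X := by
    intro m hm
    rw [Metric.mem_closedBall, dist_eq_norm, ← hxpt]
    refine (hpt _ _ _ _).trans (add_le_add (hbox m hm) ?_)
    rw [add_sub_cancel_left, abs_of_nonneg (hs0 m)]
    exact hsa m
  have hX : ∀ p ∈ X, ∀ q ∈ X, edist p q ≤ ENNReal.ofReal (2 * (M + a)) := by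
    intro p hp q hq
    rw [edist_dist]
    refine ENNReal.ofReal_le_ofReal ?_
    linarith [dist_triangle_right p q x, Metric.mem_closedBall.1 hp, Metric.mem_closedBall.1 hq]
  have hdiff : ∀ r ∈ R, ∀ i < 2 * K, edist (bot (row r i)) (bot (row r (i + 1))) ≤
      ENNReal.ofReal (W + √(2 * M * W)) ∧ edist (top (row r i)) (top (row r (i + 1))) ≤
      ENNReal.ofReal (W + √(2 * M * W)) := by
    intro r hr i hi
    have h1 := hstep _ (hrow r hr i (by omega)) _ (hrow r hr (i + 1) (by omega)) (hrowstep r i)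
    constructor
    · rw [edist_dist, dist_eq_norm]
      refine ENNReal.ofReal_le_ofReal ((hpt _ _ _ _).trans (add_le_add (hrowstep r i) ?_))
      rwa [sub_sub_sub_cancel_left, abs_sub_comm]
    · rw [edist_dist, dist_eq_norm]
      refine ENNReal.ofReal_le_ofReal ((hpt _ _ _ _).trans (add_le_add (hrowstep r i) ?_))
      rwa [add_sub_add_left_eq_sub]
  have hchord : ∀ m, edist (bot m) (top m) ≤ ENNReal.ofReal (2 * s m) := by
    intro m
    rw [edist_dist, dist_eq_norm]
    refine ENNReal.ofReal_le_ofReal ((hpt _ _ _ _).trans ?_)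
    rw [sub_self, norm_zero, zero_add, abs_le]
    constructor <;> linarith [hs0 m]
  obtain ⟨p, -, q, -, γ, hγ, -, -, hlen, hcov⟩ := exists_coveredByCurve_biUnion R
    (fun r => ∑ i ∈ Finset.range (2 * K + 1), edist (bot (row r i)) (top (row r i)) +
      ((2 * K : ℕ) : ℝ≥0∞) * ENNReal.ofReal (W + √(2 * M * W)))
    (ENNReal.ofReal (2 * (M + a)))
    (fun r => ⋃ i ∈ Finset.range (2 * K + 1), segment ℝ (bot (row r i)) (top (row r i)))
    X hX ⟨x, Metric.mem_closedBall_self (by positivity)⟩ (by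
      intro r hr
      obtain ⟨q, hq, hcov⟩ := exists_coveredByCurve_snake (fun i => bot (row r i))
        (fun i => top (row r i)) (ENNReal.ofReal (W + √(2 * M * W))) (2 * K)
        (fun i hi => (hdiff r hr i hi).1) (fun i hi => (hdiff r hr i hi).2)
      refine ⟨_, hbotX _ (hrow r hr 0 (by omega)), q, ?_, hcov⟩
      rcases hq with rfl | rfl
      · exact hbotX _ (hrow r hr _ (by omega))
      · exact htopX _ (hrow r hr _ (by omega)))
  refine ⟨γ, hγ, hlen.trans ?_, ?_⟩
  · simp only [add_assoc]
    rw [Finset.sum_add_distrib]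
    refine add_le_add ?_ ?_
    · rw [arcLengthIn_eq_tsum hv_last hU ha, ← Finset.sum_product']
      refine (Finset.sum_le_sum fun z _ => hchord (row z.1 z.2)).trans ?_
      -- Each line is used in only one row and place, so the chord lengths add up to at most the
      -- total arc length.
      have hinj : Function.Injective fun z : (Fin k → ℤ) × ℕ => row z.1 z.2 := by
        rintro ⟨r, i⟩ ⟨r', i'⟩ h
        have h' := Fin.cons_injective2 h
        rw [Prod.mk.injEq]
        exact ⟨h'.2, by have := h'.1; omega⟩
      refine (ENNReal.sum_le_tsum _).trans ?_
      exact ENNReal.tsum_comp_le_tsum_of_injective hinj fun m => ENNReal.ofReal (2 * s m)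
    · have hcard : R.card = (2 * K + 1) ^ k := by
        rw [Fintype.card_piFinset_const, Int.card_Icc]
        congr 1
        omega
      have hextra : ((2 * K : ℕ) : ℝ≥0∞) * ENNReal.ofReal (W + √(2 * M * W)) +
          ENNReal.ofReal (2 * (M + a)) =
          ENNReal.ofReal (2 * K * (W + √(2 * M * W)) + 2 * (M + a)) := by
        rw [ENNReal.ofReal_add (p := 2 * K * (W + √(2 * M * W))) (by positivity) (by positivity),
          ENNReal.ofReal_mul (p := 2 * (K : ℝ)) (by positivity), ← ENNReal.ofReal_natCast]
        push_cast
        rfl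
      rw [Finset.sum_const, hcard, nsmul_eq_mul, hextra, ENNReal.ofReal_mul (by positivity),
        ← ENNReal.ofReal_natCast]
      push_cast
      rfl
  · rintro _ ⟨⟨m, t, rfl⟩, hmem⟩
    change Fin (k + 1) → ℤ at m
    refine hcov ?_
    rw [Metric.mem_closedBall, dist_eq_norm, norm_path_sub_le_iff hv_last hU m t ha] at hmem
    change ‖lat m - x'‖ ^ 2 + (t - τ) ^ 2 ≤ a ^ 2 at hmem
    have h1 : ‖lat m - x'‖ ≤ a := abs_le_of_sq_le_sq' (by nlinarith [sq_nonneg (t - τ)]) ha |>.2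
    have h2 : |t - τ| ≤ s m := by
      rw [← Real.sqrt_sq_eq_abs]
      exact Real.sqrt_le_sqrt (by linarith)
    have hmbox : ∀ i, -(K : ℤ) ≤ m i ∧ m i ≤ K := by
      intro i
      have h3 : |(m i : ℝ)| ≤ K := by
        refine (hC m i).trans (le_trans ?_ hK)
        gcongr
        have := norm_add_le (lat m - x') x'
        rw [sub_add_cancel] at this
        exact this.trans (by linarith)
      rw [abs_le] at h3
      exact ⟨by exact_mod_cast h3.1, by exact_mod_cast h3.2⟩
    simp only [Set.mem_iUnion]
    refine ⟨Fin.tail m, Fintype.mem_piFinset.2 fun i => Finset.mem_Icc.2 (hmbox i.succ),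
      (m 0 + K).toNat, Finset.mem_range.2 ?_, ?_⟩
    · have := hmbox 0
      omega
    · have hm : row (Fin.tail m) (m 0 + K).toNat = m := by
        have h0 : (((m 0 + K).toNat : ℕ) : ℤ) - K = m 0 := by
          have := hmbox 0
          omega
        simp only [row, h0]
        exact Fin.cons_self_tail m
      rw [hm]
      have himg := image_segment ℝ (AffineMap.lineMap (k := ℝ) (sliceEmbedding U (lat m))
        (sliceEmbedding U (lat m) + e)) (τ - s m) (τ + s m)
      have hline : ∀ t : ℝ, AffineMap.lineMap (k := ℝ) (sliceEmbedding U (lat m))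
          (sliceEmbedding U (lat m) + e) t = pt (lat m) t := by
        intro t
        rw [AffineMap.lineMap_apply_module']
        simp only [pt]
        module
      simp only [hline] at himg
      rw [uniformSet_path hv_last hU m t]
      change pt (lat m) t ∈ segment ℝ (pt (lat m) (τ - s m)) (pt (lat m) (τ + s m))
      rw [← himg, segment_eq_Icc (by linarith [hs0 m])]
      refine ⟨t, ?_, rfl⟩
      rw [abs_le] at h2
      constructor <;> linarith [h2.1, h2.2]

theorem isNondegenerate_uniformSet (hv : LinearIndependent ℝ v)
    (hv_last : ∀ i, inner ℝ (v i) (v (Fin.last (k + 1))) =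
      if i = Fin.last (k + 1) then 1 else 0)
    (hU : U (v (Fin.last (k + 1))) = EuclideanSpace.single (Fin.last (k + 1)) 1) :
    (uniformSet v).IsNondegenerate := by
  intro x
  obtain ⟨C, hC0, hC⟩ := exists_abs_le_mul_norm_projectedPoint
    (linearIndependent_omitLast hv hv_last hU)
  set W := ∑ i : Fin (k + 1), ‖omitLast (U (v i.castSucc))‖ with hW
  have hW0 : 0 ≤ W := Finset.sum_nonneg fun _ _ => norm_nonneg _
  let K : ℝ → ℕ := fun a => ⌈C * (a + ‖omitLast (U x)‖)⌉₊
  let M : ℝ → ℝ := fun a => K a * W + ‖omitLast (U x)‖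
  -- With `K` and `M` of order `a`, a connection within a row costs `O(√a) = o(a)`, so the total is
  -- `O(a^k) · o(a²) = o(a^(k+2))`.
  refine ⟨fun a => (2 * K a + 1) ^ k * (2 * K a * (W + √(2 * M a * W)) + 2 * (M a + a)), ?_, ?_⟩
  · have hid : (fun a : ℝ => a) =O[atTop] fun a => a := Asymptotics.isBigO_refl _ _
    have hconst : ∀ c : ℝ, (fun _ : ℝ => c) =o[atTop] fun a => a :=
      fun c => Asymptotics.isLittleO_const_id_atTop c
    have hKO : (fun a => (K a : ℝ)) =O[atTop] fun a => a := by
      have h1 : (fun a : ℝ => C * (a + ‖omitLast (U x)‖) + 1) =O[atTop] fun a => a :=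
        ((hid.add (hconst _).isBigO).const_mul_left C).add (hconst 1).isBigO
      refine Asymptotics.IsBigO.trans (Asymptotics.IsBigO.of_bound' ?_) h1
      filter_upwards [eventually_ge_atTop 0] with a ha
      have h2 : 0 ≤ C * (a + ‖omitLast (U x)‖) := by positivity
      rw [Real.norm_of_nonneg (by positivity), Real.norm_of_nonneg (by positivity)]
      exact (Nat.ceil_lt_add_one h2).le
    have hMO : M =O[atTop] fun a => a :=
      ((hKO.const_mul_left W).congr_left fun a => mul_comm _ _).add (hconst _).isBigO
    have hδ : (fun a => W + √(2 * M a * W)) =o[atTop] fun a => a := by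
      refine (hconst W).add ?_
      have h1 : (fun a => 2 * M a * W) =O[atTop] fun a => a :=
        (hMO.const_mul_left (2 * W)).congr_left fun a => by ring
      exact (h1.sqrt (eventually_ge_atTop 0)).trans_isLittleO isLittleO_sqrt_id
    have hpow : (fun a => (2 * (K a : ℝ) + 1) ^ k) =O[atTop] fun a => a ^ k :=
      ((hKO.const_mul_left 2).add (hconst 1).isBigO).pow k
    have h2 : (fun a => 2 * (K a : ℝ) * (W + √(2 * M a * W))) =o[atTop] fun a => a * a :=
      (hKO.const_mul_left 2).mul_isLittleO hδ
    have h3 : (fun a => 2 * (M a + a)) =o[atTop] fun a : ℝ => a * a := by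
      have h4 : (fun a : ℝ => (1 : ℝ) * a) =o[atTop] fun a => a * a :=
        (hconst 1).mul_isBigO hid
      simp only [one_mul] at h4
      exact ((hMO.add hid).const_mul_left 2).trans_isLittleO h4
    refine (hpow.mul_isLittleO (h2.add h3)).congr_right fun a => ?_
    ring
  · filter_upwards [eventually_ge_atTop 0] with a ha
    exact exists_curve_through_ball hv_last hU hC hC0 x ha le_rfl (Nat.le_ceil _) le_rfl

end Nondegenerate

/-! ### Densities -/

section Density

variable {n : ℕ} {w : Fin n → Space n}

/-- The parallelepiped spanned by a linearly independent family. -/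
noncomputable def latticeCell (hw : LinearIndependent ℝ w) : Set (Space n) :=
  ZSpan.fundamentalDomain (basisOfLinearIndependentOfCardEqFinrank' w hw (by simp))

theorem lintegral_eq_tsum_latticeCell (hw : LinearIndependent ℝ w) (g : Space n → ℝ≥0∞) :
    ∫⁻ y, g y = ∑' m : Fin n → ℤ, ∫⁻ y in latticeCell hw, g (∑ i, (m i : ℝ) • w i + y) := by
  set b := basisOfLinearIndependentOfCardEqFinrank' w hw (by simp) with hb
  have hbw : ∀ i, b i = w i := fun i => by simp [hb]
  have hD := ZSpan.isAddFundamentalDomain' b (volume : Measure (Space n))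
  let e : (Fin n → ℤ) ≃ (Submodule.span ℤ (Set.range b)).toAddSubgroup :=
    (b.restrictScalars ℤ).equivFun.symm.toEquiv
  have : Countable (Submodule.span ℤ (Set.range b)).toAddSubgroup := e.symm.injective.countable
  rw [hD.lintegral_eq_tsum'' g]
  rw [← e.tsum_eq]
  refine tsum_congr fun m => ?_
  have he : (e m : Space n) = ∑ i, (m i : ℝ) • w i := by
    change (((b.restrictScalars ℤ).equivFun.symm m : Submodule.span ℤ (Set.range b)) : Space n) = _
    rw [Module.Basis.equivFun_symm_apply, Submodule.coe_sum]
    refine Finset.sum_congr rfl fun i _ => ?_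
    rw [Submodule.coe_smul, Module.Basis.restrictScalars_apply, hbw, Int.cast_smul_eq_zsmul]
  rw [← he]
  rfl

theorem volume_latticeCell_ne_zero (hw : LinearIndependent ℝ w) :
    volume (latticeCell hw) ≠ 0 :=
  ZSpan.measure_fundamentalDomain_ne_zero _

theorem exists_norm_le_of_mem_latticeCell (hw : LinearIndependent ℝ w) :
    ∃ ρ : ℝ, 0 < ρ ∧ ∀ y ∈ latticeCell hw, ‖y‖ ≤ ρ :=
  (ZSpan.fundamentalDomain_isBounded _).exists_pos_norm_le

theorem volume_latticeCell_ne_top (hw : LinearIndependent ℝ w) :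
    volume (latticeCell hw) ≠ ∞ :=
  (ZSpan.fundamentalDomain_isBounded _).measure_lt_top.ne

theorem measurableSet_latticeCell (hw : LinearIndependent ℝ w) :
    MeasurableSet (latticeCell hw) :=
  ZSpan.fundamentalDomain_measurableSet _

/-- Each lattice value is compared with an integral over its translated cell. Two functions are
allowed so that `g` can be the analogue of `f` for a ball enlarged by the cell radius `ρ`. -/
theorem volume_mul_tsum_le_lintegral (hw : LinearIndependent ℝ w) {ρ : ℝ}
    (hρ : ∀ y ∈ latticeCell hw, ‖y‖ ≤ ρ) {f g : Space n → ℝ≥0∞}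
    (hfg : ∀ y z, ‖y - z‖ ≤ ρ → f y ≤ g z) :
    volume (latticeCell hw) * ∑' m : Fin n → ℤ, f (∑ i, (m i : ℝ) • w i) ≤ ∫⁻ y, g y := by
  rw [lintegral_eq_tsum_latticeCell hw, ← ENNReal.tsum_mul_left]
  refine ENNReal.tsum_le_tsum fun m => ?_
  rw [mul_comm, ← setLIntegral_const]
  refine setLIntegral_mono' (measurableSet_latticeCell hw) fun y hy => hfg _ _ ?_
  rw [sub_add_cancel_left, norm_neg]
  exact hρ y hy

theorem lintegral_le_volume_mul_tsum (hw : LinearIndependent ℝ w) {ρ : ℝ}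
    (hρ : ∀ y ∈ latticeCell hw, ‖y‖ ≤ ρ) {f g : Space n → ℝ≥0∞}
    (hfg : ∀ y z, ‖y - z‖ ≤ ρ → g z ≤ f y) :
    ∫⁻ y, g y ≤ volume (latticeCell hw) * ∑' m : Fin n → ℤ, f (∑ i, (m i : ℝ) • w i) := by
  rw [lintegral_eq_tsum_latticeCell hw, ← ENNReal.tsum_mul_left]
  refine ENNReal.tsum_le_tsum fun m => ?_
  rw [mul_comm (volume _), ← setLIntegral_const]
  refine setLIntegral_mono' (measurableSet_latticeCell hw) fun y hy => hfg _ _ ?_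
  rw [sub_add_cancel_left, norm_neg]
  exact hρ y hy

theorem encard_latticePoints_inter (hw : LinearIndependent ℝ w) (B : Set (Space n)) :
    ((latticePoints w ∩ B).encard : ℝ≥0∞) =
      ∑' m : Fin n → ℤ, B.indicator (fun _ => 1) (∑ i, (m i : ℝ) • w i) := by
  let lat : (Fin n → ℤ) → Space n := fun m => ∑ i, (m i : ℝ) • w i
  have hinj : Function.Injective lat := by
    intro m m' h
    have := hw.fintypeLinearCombination_injective (a₁ := fun i => (m i : ℝ))
      (a₂ := fun i => (m' i : ℝ)) (by simpa [Fintype.linearCombination_apply] using h)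
    ext i
    exact_mod_cast congrFun this i
  have h1 : latticePoints w ∩ B = lat '' (lat ⁻¹' B) := by
    rw [Set.image_preimage_eq_range_inter]
    rfl
  rw [h1, hinj.injOn.encard_image, ← ENNReal.tsum_set_one,
    tsum_subtype (lat ⁻¹' B) fun _ => (1 : ℝ≥0∞)]
  rfl

theorem tendsto_volume_closedBall_div {d : ℕ} (x : Space d) (r : ℝ) :
    Tendsto (fun a : ℝ => volume (Metric.closedBall x (a + r)) /
      volume (Metric.closedBall (0 : Space d) a)) atTop (𝓝 1) := by
  have h1 : Tendsto (fun a : ℝ => ENNReal.ofReal (((a + r) / a) ^ d)) atTop (𝓝 1) := by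
    have h2 : Tendsto (fun a : ℝ => (1 + r / a) ^ d) atTop (𝓝 ((1 + 0) ^ d)) :=
      (tendsto_const_nhds.add (tendsto_const_nhds.div_atTop tendsto_id)).pow d
    rw [add_zero, one_pow] at h2
    have h3 := ENNReal.tendsto_ofReal h2
    rw [ENNReal.ofReal_one] at h3
    refine h3.congr' ?_
    filter_upwards [eventually_gt_atTop 0] with a ha
    rw [add_div, div_self ha.ne']
  refine h1.congr' ?_
  filter_upwards [eventually_gt_atTop 0, eventually_ge_atTop (-r)] with a ha har
  rw [Measure.addHaar_closedBall _ _ (by linarith), Measure.addHaar_closedBall _ _ ha.le,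
    finrank_euclideanSpace_fin, ENNReal.mul_div_mul_right, div_pow,
    ENNReal.ofReal_div_of_pos (by positivity)]
  · exact (Metric.measure_ball_pos _ _ one_pos).ne'
  · exact measure_ball_lt_top.ne

/-- Squeezing: changing the radius by a constant does not affect the leading order of the volume. -/
theorem tendsto_div_volume_closedBall {d : ℕ} {c : ℝ≥0∞} (hc0 : c ≠ 0) (hc : c ≠ ∞) (x : Space d)
    (ρ : ℝ) {F : ℝ → ℝ≥0∞} (hle : ∀ a, c * F a ≤ volume (Metric.closedBall x (a + ρ)))
    (hge : ∀ a, volume (Metric.closedBall x (a + -ρ)) ≤ c * F a) :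
    Tendsto (fun a => F a / volume (Metric.closedBall (0 : Space d) a)) atTop (𝓝 c⁻¹) := by
  have hmul : ∀ r, Tendsto (fun a : ℝ => c⁻¹ * (volume (Metric.closedBall x (a + r)) /
      volume (Metric.closedBall (0 : Space d) a))) atTop (𝓝 c⁻¹) := fun r => by
    simpa using ENNReal.Tendsto.const_mul (tendsto_volume_closedBall_div x r)
      (Or.inr (ENNReal.inv_ne_top.2 hc0))
  have hF : ∀ a, F a = c⁻¹ * (c * F a) := fun a => by
    rw [← mul_assoc, ENNReal.inv_mul_cancel hc0 hc, one_mul]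
  refine tendsto_of_tendsto_of_tendsto_of_le_of_le (hmul (-ρ)) (hmul ρ) (fun a => ?_) fun a => ?_
  · simp only
    rw [hF a, mul_div_assoc]
    gcongr
    exact hge a
  · simp only
    rw [hF a, mul_div_assoc]
    gcongr
    exact hle a

theorem hasSamplingDensity_latticePoints (hw : LinearIndependent ℝ w) :
    HasSamplingDensity (latticePoints w) (volume (latticeCell hw))⁻¹ := by
  intro x
  obtain ⟨ρ, -, hρ⟩ := exists_norm_le_of_mem_latticeCell hw
  have hball : ∀ a, volume (Metric.closedBall x a) = volume (Metric.closedBall (0 : Space n) a) :=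
    fun a => Measure.addHaar_closedBall_center _ _ _
  have hsub : ∀ (a : ℝ) (y z : Space n), ‖y - z‖ ≤ ρ →
      (Metric.closedBall x a).indicator (fun _ => (1 : ℝ≥0∞)) y ≤
        (Metric.closedBall x (a + ρ)).indicator (fun _ => 1) z := by
    intro a y z hyz
    by_cases hy : y ∈ Metric.closedBall x a
    · have hz : z ∈ Metric.closedBall x (a + ρ) := by
        rw [Metric.mem_closedBall] at hy ⊢
        rw [← dist_eq_norm, dist_comm] at hyz
        linarith [dist_triangle z y x]
      rw [Set.indicator_of_mem hz]
      exact Set.indicator_le_self' (fun _ _ => zero_le) y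
    · rw [Set.indicator_of_notMem hy]
      exact zero_le
  simp only [hball]
  refine tendsto_div_volume_closedBall (volume_latticeCell_ne_zero hw)
    (volume_latticeCell_ne_top hw) x ρ (fun a => ?_) fun a => ?_
  · rw [encard_latticePoints_inter hw,
      ← lintegral_indicator_one (Metric.isClosed_closedBall.measurableSet)]
    exact volume_mul_tsum_le_lintegral hw hρ (hsub a)
  · rw [encard_latticePoints_inter hw,
      ← lintegral_indicator_one (Metric.isClosed_closedBall.measurableSet)]
    refine lintegral_le_volume_mul_tsum hw hρ fun y z hyz => ?_
    have := hsub (a + -ρ) z y (by rwa [norm_sub_rev])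
    rwa [neg_add_cancel_right] at this

end Density

/-! ### Path density via Fubini -/

section PathDensity

variable {n : ℕ} {v : Fin (n + 1) → Space (n + 1)}
  {U : Space (n + 1) ≃ₗᵢ[ℝ] Space (n + 1)}

theorem measurePreserving_appendZero_add :
    MeasurePreserving (fun z : Space n × ℝ =>
      appendZero z.1 + z.2 • EuclideanSpace.single (Fin.last n) (1 : ℝ)) := by
  -- The factors are swapped because `piFinSuccAbove` puts the singled-out coordinate first.
  have h1 : MeasurePreserving (fun z : Space n × ℝ => ((z.2, WithLp.ofLp z.1) : ℝ × (Fin n → ℝ))) :=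
    (Measure.measurePreserving_swap (μ := (volume : Measure (Fin n → ℝ)))
      (ν := (volume : Measure ℝ))).comp
      ((PiLp.volume_preserving_ofLp (Fin n)).prod (MeasurePreserving.id volume))
  have h2 := (volume_preserving_piFinSuccAbove (fun _ : Fin (n + 1) => ℝ) (Fin.last n)).symm
  have h3 := (PiLp.volume_preserving_toLp (Fin (n + 1))).comp (h2.comp h1)
  convert h3 using 1
  ext z i
  refine Fin.lastCases ?_ (fun j => ?_) i
  · simp [appendZero_last, MeasurableEquiv.piFinSuccAbove]
  · simp [appendZero_castSucc, MeasurableEquiv.piFinSuccAbove]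

/-- Fubini along the direction of the lines, after an isometric change of coordinates. -/
theorem lintegral_volume_chord (hU : U (v (Fin.last n)) = EuclideanSpace.single (Fin.last n) 1)
    (x : Space (n + 1)) (a : ℝ) :
    ∫⁻ y, volume {t : ℝ | ‖sliceEmbedding U y + t • v (Fin.last n) - x‖ ≤ a} =
      volume (Metric.closedBall x a) := by
  have hmp : MeasurePreserving
      (fun z : Space n × ℝ => sliceEmbedding U z.1 + z.2 • v (Fin.last n)) := by
    convert U.symm.measurePreserving.comp measurePreserving_appendZero_add using 1
    ext1 z
    rw [Function.comp_apply, map_add, map_smul, ← hU, U.symm_apply_apply, sliceEmbedding_apply]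
  have hB : MeasurableSet (Metric.closedBall x a) := Metric.isClosed_closedBall.measurableSet
  rw [← hmp.measure_preimage hB.nullMeasurableSet, Measure.volume_eq_prod,
    Measure.prod_apply (hmp.measurable hB)]
  refine lintegral_congr fun y => ?_
  congr 1

theorem volume_chord_mono (hU : U (v (Fin.last n)) = EuclideanSpace.single (Fin.last n) 1)
    (x : Space (n + 1)) (a : ℝ) {ρ : ℝ} {y z : Space n} (hyz : ‖y - z‖ ≤ ρ) :
    volume {t : ℝ | ‖sliceEmbedding U y + t • v (Fin.last n) - x‖ ≤ a} ≤
      volume {t : ℝ | ‖sliceEmbedding U z + t • v (Fin.last n) - x‖ ≤ a + ρ} := by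
  refine measure_mono fun t ht => ?_
  have h1 := norm_sub_sliceEmbedding_add_le hU z y t t
  rw [sub_self, abs_zero, add_zero, norm_sub_rev z y] at h1
  have h2 := norm_sub_le_norm_sub_add_norm_sub (sliceEmbedding U z + t • v (Fin.last n))
    (sliceEmbedding U y + t • v (Fin.last n)) x
  have h3 : ‖sliceEmbedding U y + t • v (Fin.last n) - x‖ ≤ a := ht
  change ‖sliceEmbedding U z + t • v (Fin.last n) - x‖ ≤ a + ρ
  linarith

/-- The upper limit is a true limit: the upper estimate is uniform in the centre, since the volume
of a ball is translation invariant, and the centre `0` alone gives the lower one. -/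
theorem pathDensity_uniformSet
    (hv_last : ∀ i, inner ℝ (v i) (v (Fin.last n)) = if i = Fin.last n then 1 else 0)
    (hU : U (v (Fin.last n)) = EuclideanSpace.single (Fin.last n) 1)
    (hw : LinearIndependent ℝ fun i : Fin n => omitLast (U (v i.castSucc))) :
    (uniformSet v).pathDensity = (volume (latticeCell hw))⁻¹ := by
  obtain ⟨ρ, -, hρ⟩ := exists_norm_le_of_mem_latticeCell hw
  have harc : ∀ a x, (uniformSet v).arcLengthIn a x = ∑' m : Fin n → ℤ, volume {t : ℝ |
      ‖sliceEmbedding U (∑ i, (m i : ℝ) • omitLast (U (v i.castSucc))) +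
        t • v (Fin.last n) - x‖ ≤ a} := by
    intro a x
    rw [arcLengthIn_eq_tsum_volume hv_last]
    simp only [uniformSet_path hv_last hU, projectedPoint]
  refine Tendsto.limsup_eq ?_
  refine tendsto_div_volume_closedBall (volume_latticeCell_ne_zero hw)
    (volume_latticeCell_ne_top hw) 0 ρ (fun a => ?_) fun a => ?_
  · rw [ENNReal.mul_iSup]
    refine iSup_le fun x => ?_
    rw [← Measure.addHaar_closedBall_center _ x, ← lintegral_volume_chord hU, harc]
    exact volume_mul_tsum_le_lintegral hw hρ fun y z hyz => volume_chord_mono hU x a hyz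
  · refine le_trans ?_ (mul_le_mul_right (le_iSup _ 0) _)
    rw [← lintegral_volume_chord hU, harc]
    refine lintegral_le_volume_mul_tsum hw hρ (f := fun y => volume {t : ℝ |
      ‖sliceEmbedding U y + t • v (Fin.last n) - 0‖ ≤ a}) fun y z hyz => ?_
    have := volume_chord_mono hU 0 (a + -ρ) (ρ := ρ) (y := z) (z := y)
      (by rwa [norm_sub_rev])
    rwa [neg_add_cancel_right] at this

end PathDensity

end PathSampling

theorem proposition3 (n : ℕ) (hn : 1 ≤ n)
    (Ω : Set (PathSampling.Space (n + 1))) (hΩ_compact : IsCompact Ω) (hΩ_convex : Convex ℝ Ω)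
    (hΩ_symm : ∀ x ∈ Ω, -x ∈ Ω) (hΩ_int : (interior Ω).Nonempty)
    (v : Fin (n + 1) → PathSampling.Space (n + 1)) (hv : LinearIndependent ℝ v)
    (hv_last : ∀ i, inner ℝ (v i) (v (Fin.last n)) = if i = Fin.last n then 1 else 0)
    (U : PathSampling.Space (n + 1) ≃ₗᵢ[ℝ] PathSampling.Space (n + 1))
    (hU : U (v (Fin.last n)) = EuclideanSpace.single (Fin.last n) 1) :
    ((PathSampling.uniformSet v).IsNyquist Ω ↔
      PathSampling.IsSamplingLattice (PathSampling.slice U Ω)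
        (PathSampling.projectedLattice U v)) ∧
    PathSampling.HasSamplingDensity (PathSampling.projectedLattice U v)
      (PathSampling.uniformSet v).pathDensity := by
  have hw := PathSampling.linearIndependent_omitLast hv hv_last hU
  refine ⟨⟨?_, fun h => ⟨?_, ?_⟩⟩, ?_⟩
  · rintro ⟨⟨Λ, hΛ, hsamp⟩, -⟩
    exact PathSampling.isSamplingLattice_of_isSamplingSet hΩ_compact hΩ_convex hΩ_symm hΩ_int hv
      hv_last hU hΛ hsamp
  · exact PathSampling.exists_isSamplingSet hΩ_compact hΩ_convex hΩ_symm hv hv_last hU h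
  -- Dimension at least 2 provides the lattice direction along which rows are formed.
  · obtain ⟨k, rfl⟩ := Nat.exists_eq_add_of_le' hn
    exact PathSampling.isNondegenerate_uniformSet hv hv_last hU
  · rw [PathSampling.pathDensity_uniformSet hv_last hU hw]
    exact PathSampling.hasSamplingDensity_latticePoints hw
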